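/- **Setting.** Let $\mathscr P_2(\mathbb R^d)$ be the Borel probability measures on $\mathbb R^d$ with finite second moment, with the Wasserstein distance $W_2$. Let $F:\mathscr P_2(\mathbb R^d)\times\mathbb R^d\rightrightarrows\mathbb R^d$ have nonempty, convex, compact images and be Lipschitz continuous with constant $L>0$ with respect to $W_2(\mu_1,\mu_2)+|x_1-x_2|$, i.e. $F(\mu_2,x_2)\subseteq F(\mu_1,x_1)+L\,(W_2(\mu_1,\mu_2)+|x_1-x_2|)\,\overline{B(0,1)}$. For $\mu\in\mathscr P_2(\mathbb R^d)$ and a compact interval $I=[a,b]$, $\mathcal A_I(\mu)$ is the set of $W_2$-continuous curves $\{\mu_t\}_{t\in I}\subseteq\mathscr P_2(\mathbb R^d)$ with $\mu_a=\mu$ that solve $\partial_t\mu_t+\mathrm{div}(v_t\mu_t)=0$ in the sense of distributions for a Borel field $v$ with $v_t\in L^1_{\mu_t}$ and $v_t(x)\in F(\mu_t,x)$ for a.e. $t\in I$ and $\mu_t$-a.e. $x$. Let $\phi:\mathbb R^d\to\mathbb R$ be continuous and bounded, $\Phi=\{\phi\}$, $\sigma_\Phi(\mu)=\int\phi\,d\mu$,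 $\tilde S_2^\Phi=\{\mu\in\mathscr P_2(\mathbb R^d):\sigma_\Phi(\mu)\le 0\}$, and $$\tilde T_2^\Phi(\mu)=\inf\{T\ge0:\ \exists\,\{\mu_t\}\in\mathcal A_{[0,T]}(\mu)\text{ with }\mu_T\in\tilde S^\Phi_2\}\in[0,+\infty].$$ Write $s^+=\max\{s,0\}$. **Hypotheses.** Let $\mathcal D\subseteq\mathscr P_2(\mathbb R^d)$, $C_\phi\ge0$, $K>0$, $0\le\alpha<\beta-1$, and set $t_\mu=\min\{1,\tfrac1{2L},(\sigma_\Phi(\mu)^+)^{1/\beta}\}$, $I_\mu=[0,t_\mu]$. Assume: a) $\phi$ is semiconcave with constant $C_\phi$: $(1-t)\phi(x)+t\phi(y)\le\phi((1-t)x+ty)+C_\phi\,t(1-t)|x-y|^2$ for all $x,y\in\mathbb R^d$ and $t\in[0,1]$; b) for every $\mu\in\mathcal D\setminus\tilde S_2^\Phi$ there are $v_\mu,\xi_\mu\in L^2_\mu(\mathbb R^d;\mathbb R^d)$, a Borel probability measure $\boldsymbol\eta$ on $\mathbb R^d\times C(I_\mu;\mathbb R^d)$, and constants $C_{2,\mu},C_{3,\mu},C_{4,\mu}>0$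 such that, with $e_t(x,\gamma)=\gamma(t)$, - $\{e_t\sharp\boldsymbol\eta\}_{t\in I_\mu}\in\mathcal A_{I_\mu}(\mu)$ and $e_{t_\mu}\sharp\boldsymbol\eta\in\mathcal D$; - $\xi_\mu(x)\in\partial^P\phi(x)$ for $\mu$-a.e. $x$, where $\xi\in\partial^P\phi(x)$ means that there are $c\in\mathbb R$ and $r>0$ with $\phi(y)\le\phi(x)+\langle\xi,y-x\rangle+c|y-x|^2$ whenever $|y-x|<r$; - $\int\langle\xi_\mu,v_\mu\rangle\,d\mu\le-C_{2,\mu}<0$; - $\Big(\int\Big|\frac{\gamma(t_\mu)-\gamma(0)}{t_\mu^{1+\alpha}}-v_\mu(\gamma(0))\Big|^2d\boldsymbol\eta(x,\gamma)\Big)^{1/2}\le C_{3,\mu}t_\mu$; - $\|v_\mu\|_{L^2_\mu}\le C_{4,\mu}$; - $-C_{2,\mu}+C_{3,\mu}\|\xi_\mu\|_{L^2_\mu}t_\mu+2C_\phi(C_{3,\mu}^2t_\mu^2+C_{4,\mu}^2)t_\mu^{\alpha+1}\le-2K\,t_\mu$. For $q\ge0$ put $$B(q)=\begin{cases}\dfrac{\beta\,q^{\frac{\beta-\alpha-1}{\beta}}}{K(\beta-\alpha-1)},&q\le\min\{1,(2L)^{-\beta}\},\\[2ex]\dfrac{\beta(2L)^{-\beta+\alpha+1}}{K(\beta-\alpha-1)}+\dfrac1K(2L)^{\alpha+1}(q-(2L)^{-\beta}),&q\ge(2L)^{-\beta}=\min\{1,(2L)^{-\beta}\},\\[2ex]\dfrac{\beta}{K(\beta-\alpha-1)}+\dfrac1K(q-1),&q\ge1=\min\{1,(2L)^{-\beta}\}.\end{cases}$$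 **Conclusions.** 1. (STLA) holds in $\mathcal D$: for every $\varepsilon>0$ and $\hat\mu\in\tilde S_2^\Phi$ there is $\delta>0$ such that $\tilde T_2^\Phi(\mu)\le\varepsilon$ for all $\mu\in\mathcal D$ with $W_2(\mu,\hat\mu)\le\delta$. 2. $\tilde T_2^\Phi(\mu)\le B(\sigma_\Phi(\mu)^+)+t_\mu$ for all $\mu\in\mathcal D$. 3. If moreover $K\,t_\nu^{\alpha+2}\le\sigma_\Phi(\nu)$ for all $\nu\in\mathcal D\setminus\tilde S_2^\Phi$ (for instance, if the measures $e_{t_\nu}\sharp\boldsymbol\eta$ in b) all satisfy $\sigma_\Phi\ge0$, or if $K\le1$ and $\beta\le\alpha+2$), then $\tilde T_2^\Phi(\mu)\le B(\sigma_\Phi(\mu)^+)$ for all $\mu\in\mathcal D$. -/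

import Mathlib

open MeasureTheory Set Filter Topology
open scoped ENNReal BoundedContinuousFunction

noncomputable section

namespace WassersteinTarget

/-- The Euclidean space of dimension `d`. -/
abbrev E (d : ℕ) : Type := EuclideanSpace ℝ (Fin d)

/-- Borel probability measures on `E d` with finite second moment. -/
def P2 (d : ℕ) : Type :=
  {μ : ProbabilityMeasure (E d) // ∫⁻ x, ‖x‖ₑ ^ 2 ∂(μ : Measure (E d)) < ∞}

/-- The underlying measure of an element of `P2 d`. -/
def P2.meas {d : ℕ} (μ : P2 d) : Measure (E d) := (μ.1 : Measure (E d))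

instance {d : ℕ} (μ : P2 d) : IsProbabilityMeasure μ.meas := by
  unfold P2.meas; infer_instance

/-- Transport plans between two measures. -/
def plans {d : ℕ} (μ ν : Measure (E d)) : Set (Measure (E d × E d)) :=
  {π | π.map Prod.fst = μ ∧ π.map Prod.snd = ν}

/-- The `2`-Wasserstein distance, with values in `[0, ∞]` (it is finite on `P2 d`). -/
def W2 {d : ℕ} (μ ν : P2 d) : ℝ≥0∞ :=
  (⨅ π ∈ plans μ.meas ν.meas, ∫⁻ z, edist z.1 z.2 ^ 2 ∂π) ^ (1 / 2 : ℝ)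

/-- The standing assumption on the dynamics: `F` has nonempty, convex, compact images and is
Lipschitz continuous with constant `L > 0`, that is
`F (μ₂, x₂) ⊆ F (μ₁, x₁) + L (W₂ (μ₁, μ₂) + |x₁ - x₂|) B̄(0, 1)`. -/
structure StandingHyp {d : ℕ} (F : P2 d → E d → Set (E d)) (L : ℝ) : Prop where
  pos : 0 < L
  nonempty : ∀ μ x, (F μ x).Nonempty
  convex : ∀ μ x, Convex ℝ (F μ x)
  compact : ∀ μ x, IsCompact (F μ x)
  lipschitz : ∀ μ₁ x₁ μ₂ x₂, ∀ y ∈ F μ₂ x₂, ∃ z ∈ F μ₁ x₁,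
    edist y z ≤ ENNReal.ofReal L * (W2 μ₁ μ₂ + edist x₁ x₂)

/-- Admissible trajectories on `[a, b]`: `W₂`-continuous curves `t ↦ μ_t` in `P2 d` such that
`∂_t μ_t + div (v_t μ_t) = 0` for a Borel field `v` with `v_t ∈ L¹(μ_t)` and `v_t (x) ∈ F (μ_t, x)`
for a.e. `t` and `μ_t`-a.e. `x`. (The vector measure driving the curve is `ν_t = v_t μ_t`, so
`v_t` is its density.) The continuity equation is written in its weak form: for every
`ψ ∈ C¹_c`, the function `t ↦ ∫ ψ dμ_t` is absolutely continuous on `[a, b]` with a.e.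
derivative `∫ ⟨∇ψ, v_t⟩ dμ_t`. Values of the curve outside `[a, b]` play no role. -/
structure IsAdmissible {d : ℕ} (F : P2 d → E d → Set (E d)) (a b : ℝ) (μ : ℝ → P2 d) :
    Prop where
  continuous : ∀ t ∈ Icc a b, Tendsto (fun s => W2 (μ s) (μ t)) (𝓝[Icc a b] t) (𝓝 0)
  driven : ∃ v : ℝ → E d → E d, Measurable (Function.uncurry v) ∧
    (∀ᵐ t ∂(volume.restrict (Icc a b)),
      Integrable (v t) (μ t).meas ∧ ∀ᵐ x ∂(μ t).meas, v t x ∈ F (μ t) x) ∧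
    ∀ ψ : E d → ℝ, ContDiff ℝ 1 ψ → HasCompactSupport ψ →
      IntegrableOn (fun t => ∫ x, fderiv ℝ ψ x (v t x) ∂(μ t).meas) (Icc a b) ∧
      ∀ s ∈ Icc a b, ∀ t ∈ Icc a b,
        ∫ x, ψ x ∂(μ t).meas - ∫ x, ψ x ∂(μ s).meas =
          ∫ τ in s..t, ∫ x, fderiv ℝ ψ x (v τ x) ∂(μ τ).meas

/-- The set of admissible trajectories on `[a, b]` that start from `μ`. -/
def Adm {d : ℕ} (F : P2 d → E d → Set (E d)) (a b : ℝ) (μ : P2 d) : Set (ℝ → P2 d) :=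
  {c | IsAdmissible F a b c ∧ c a = μ}

/-- The generalized target in `P2 d` generated by a family `Φ` of observables. -/
def target {d : ℕ} (Φ : Set (E d →ᵇ ℝ)) : Set (P2 d) :=
  {μ | ∀ φ ∈ Φ, ∫ x, φ x ∂μ.meas ≤ 0}

/-- `σ_Φ (μ) = sup_{φ ∈ Φ} ∫ φ dμ` (a supremum of real numbers, for families `Φ` for which it is
finite; for `Φ = {φ}` it is `∫ φ dμ`, see `sigma_singleton`). -/
def sigma {d : ℕ} (Φ : Set (E d →ᵇ ℝ)) (μ : P2 d) : ℝ :=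
  sSup ((fun φ : E d →ᵇ ℝ => ∫ x, φ x ∂μ.meas) '' Φ)

theorem sigma_singleton {d : ℕ} (φ : E d →ᵇ ℝ) (μ : P2 d) :
    sigma {φ} μ = ∫ x, φ x ∂μ.meas := by
  simp [sigma]

/-- The generalized minimum time function, with values in `[0, ∞]`. -/
def minTime {d : ℕ} (F : P2 d → E d → Set (E d)) (Φ : Set (E d →ᵇ ℝ)) (μ : P2 d) : ℝ≥0∞ :=
  sInf {s | ∃ T : ℝ, 0 ≤ T ∧ (∃ c ∈ Adm F 0 T μ, c T ∈ target Φ) ∧ s = ENNReal.ofReal T}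

/-- Small-time local attainability in `D`: for every `ε > 0` and every `μ̂` in the target
there is `δ > 0` with `T̃₂ (μ) ≤ ε` for all `μ ∈ D` such that `W₂ (μ, μ̂) ≤ δ`. -/
def STLAOn {d : ℕ} (F : P2 d → E d → Set (E d)) (Φ : Set (E d →ᵇ ℝ)) (D : Set (P2 d)) : Prop :=
  ∀ ε : ℝ, 0 < ε → ∀ μhat ∈ target Φ, ∃ δ : ℝ, 0 < δ ∧
    ∀ μ ∈ D, W2 μ μhat ≤ ENNReal.ofReal δ → minTime F Φ μ ≤ ENNReal.ofReal ε

/-- Semiconcavity with constant `C`. -/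
def SemiconcaveWith {d : ℕ} (φ : E d → ℝ) (C : ℝ) : Prop :=
  ∀ x y : E d, ∀ t ∈ Icc (0 : ℝ) 1,
    (1 - t) * φ x + t * φ y ≤ φ ((1 - t) • x + t • y) + C * t * (1 - t) * ‖x - y‖ ^ 2

/-- The proximal superdifferential of `φ` at `x`. -/
def proxSuperdiff {d : ℕ} (φ : E d → ℝ) (x : E d) : Set (E d) :=
  {ξ | ∃ c : ℝ, ∃ r > 0, ∀ y, ‖y - x‖ < r →
    φ y ≤ φ x + inner ℝ ξ (y - x) + c * ‖y - x‖ ^ 2}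

/-- The space of continuous curves `[0, T] → E d` with the uniform topology. -/
abbrev Curves (d : ℕ) (T : ℝ) : Type := C(Icc (0 : ℝ) T, E d)

instance {d : ℕ} {T : ℝ} : MeasurableSpace (Curves d T) := borel _

instance {d : ℕ} {T : ℝ} : BorelSpace (Curves d T) := ⟨rfl⟩

/-- The evaluation `γ (t)` of a curve on `[0, T]`; only used for `t ∈ [0, T]`. -/
def evalCurve {d : ℕ} {T : ℝ} (γ : Curves d T) (t : ℝ) : E d :=
  if h : t ∈ Icc (0 : ℝ) T then γ ⟨t, h⟩ else 0

/-- The vector whose norm is `Δ^v_{α, γ} (t)`: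
`(γ (t) - γ (0)) / t ^ (1 + α) - v (γ (0))`. -/
def deltaVec {d : ℕ} {T : ℝ} (α : ℝ) (v : E d → E d) (γ : Curves d T) (t : ℝ) : E d :=
  (t ^ (1 + α))⁻¹ • (evalCurve γ t - evalCurve γ 0) - v (evalCurve γ 0)

/-- The time step `t_μ = min {1, 1 / (2 L), σ_Φ (μ) ^ (1 / β)}`; the positive part of `σ_Φ (μ)`
is taken, so that `t_μ = 0` on the target. -/
def stepTime {d : ℕ} (Φ : Set (E d →ᵇ ℝ)) (L β : ℝ) (μ : P2 d) : ℝ :=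
  min 1 (min (1 / (2 * L)) (max (sigma Φ μ) 0 ^ (1 / β)))

/-- The descent condition at `μ`, with parameters `α, β, K`, the Lipschitz constant `L` of `F`
and the semiconcavity constant `C` of `φ`. -/
def DescentAt {d : ℕ} (F : P2 d → E d → Set (E d)) (φ : E d →ᵇ ℝ) (D : Set (P2 d))
    (L C α β K : ℝ) (μ : P2 d) : Prop :=
  ∃ (v ξ : E d → E d) (η : ProbabilityMeasure (E d × Curves d (stepTime {φ} L β μ)))
    (C₂ C₃ C₄ : ℝ),
    0 < C₂ ∧ 0 < C₃ ∧ 0 < C₄ ∧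
    MemLp v 2 μ.meas ∧ MemLp ξ 2 μ.meas ∧
    (∃ c ∈ Adm F 0 (stepTime {φ} L β μ) μ,
      (∀ t ∈ Icc 0 (stepTime {φ} L β μ),
        (c t).meas = (η : Measure (E d × Curves d (stepTime {φ} L β μ))).map
        (fun z => evalCurve z.2 t)) ∧
      c (stepTime {φ} L β μ) ∈ D) ∧
    (∀ᵐ x ∂μ.meas, ξ x ∈ proxSuperdiff φ x) ∧
    ∫ x, inner ℝ (ξ x) (v x) ∂μ.meas ≤ -C₂ ∧
    eLpNorm (fun z : E d × Curves d (stepTime {φ} L β μ) =>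
        deltaVec α v z.2 (stepTime {φ} L β μ)) 2
        (η : Measure (E d × Curves d (stepTime {φ} L β μ)))
      ≤ ENNReal.ofReal (C₃ * stepTime {φ} L β μ) ∧
    eLpNorm v 2 μ.meas ≤ ENNReal.ofReal C₄ ∧
    -C₂ + C₃ * (eLpNorm ξ 2 μ.meas).toReal * stepTime {φ} L β μ
        + 2 * C * (C₃ ^ 2 * stepTime {φ} L β μ ^ 2 + C₄ ^ 2) * stepTime {φ} L β μ ^ (α + 1)
      ≤ -(2 * K * stepTime {φ} L β μ)

/-- The explicit upper bound for the minimum time, as a function of `q = σ_Φ (μ) ≥ 0`. -/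
def timeBound (L α β K q : ℝ) : ℝ :=
  if q ≤ min 1 ((2 * L) ^ (-β)) then
    β * q ^ ((β - α - 1) / β) / (K * (β - α - 1))
  else if (2 * L) ^ (-β) ≤ 1 then
    β * (2 * L) ^ (-β + α + 1) / (K * (β - α - 1))
      + 1 / K * (2 * L) ^ (α + 1) * (q - (2 * L) ^ (-β))
  else
    β / (K * (β - α - 1)) + 1 / K * (q - 1)

end WassersteinTarget

end

open WassersteinTarget

namespace WassersteinTarget

/-! ### The Wasserstein distance -/

/-! The curve that reaches the target is built greedily, one descent step after another. For a step
of length `t` from `μ` outside the target, the displacement along `η` is `t ^ (1 + α)` times `v_μ +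
Δ`, where `Δ` has `L²` norm at most `C₃ t`. Semiconcavity makes the proximal inequality global with
constant `C`. Integrating it and using the last inequality of the descent condition shows that the
observable drops by at least `2 K t ^ (α + 2)` (`DescentAt.exists_step`).

The bound `B` is the concave function with `B 0 = 0` and `B' (q) = 1 / (K t(q) ^ (α + 1))`, where
`t(q)` is the time step at the value `q`. The tangent inequality turns a drop of `2 K t ^ (α + 2)`
into a drop of at least `2 t` in `B` (`two_mul_stepFun_add_timeBound_le`). As long as the observable
stays positive, twice the elapsed time plus the current value of `B` is therefore at most `B (σ
(μ))`. If the target is reached after finitely many steps, only the last step needs care, since it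
may overshoot zero: it is at most `t_μ`, and under the extra hypothesis of the third conclusion it
is paid for by the remaining value of `B`.

Otherwise the steps sum to a finite time `T ≤ B (σ (μ))`, and the concatenated curve lives on `[0,
T)`. It extends to `T` (`StandingHyp.exists_extension`): `F` has linear growth, so second moments
stay bounded and their tails stay uniformly small near `T`; the weak equation gives limits of
integrals of test functions, tightness makes them the integrals of a measure, and the small tails
improve this to `W2` convergence. The steps tend to zero, so the observable does too. A bounded
semiconcave function is Lipschitz, so the observable is `W2`-continuous and the limit lies in the
target.

Small-time attainability follows, because `B` and the time step tend to zero as the observable tends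
to zero. -/

theorem W2_le_of_plan {d : ℕ} {μ ν : P2 d} {π : Measure (E d × E d)}
    (hπ : π ∈ plans μ.meas ν.meas) {r : ℝ≥0∞} (h : ∫⁻ z, edist z.1 z.2 ^ 2 ∂π ≤ r ^ 2) :
    W2 μ ν ≤ r := by
  have h1 : (⨅ π ∈ plans μ.meas ν.meas, ∫⁻ z, edist z.1 z.2 ^ 2 ∂π) ≤ r ^ 2 :=
    (iInf₂_le π hπ).trans h
  calc W2 μ ν ≤ (r ^ 2) ^ (1 / 2 : ℝ) := ENNReal.rpow_le_rpow h1 (by norm_num)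
    _ = r := by
      rw [← ENNReal.rpow_natCast, ← ENNReal.rpow_mul]; norm_num

theorem exists_plan_of_W2_lt {d : ℕ} {μ ν : P2 d} {r : ℝ≥0∞} (h : W2 μ ν < r) :
    ∃ π ∈ plans μ.meas ν.meas, ∫⁻ z, edist z.1 z.2 ^ 2 ∂π < r ^ 2 := by
  by_contra! hcon
  have h1 : r ^ 2 ≤ ⨅ π ∈ plans μ.meas ν.meas, ∫⁻ z, edist z.1 z.2 ^ 2 ∂π := le_iInf₂ hcon
  have h2 : (r ^ 2) ^ (1 / 2 : ℝ) ≤ W2 μ ν := ENNReal.rpow_le_rpow h1 (by norm_num)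
  rw [← ENNReal.rpow_natCast, ← ENNReal.rpow_mul] at h2
  norm_num at h2
  exact absurd h (not_lt.2 h2)

theorem isProbabilityMeasure_of_mem_plans {d : ℕ} {μ ν : P2 d} {π : Measure (E d × E d)}
    (hπ : π ∈ plans μ.meas ν.meas) : IsProbabilityMeasure π := by
  constructor
  have h := congrArg (fun m : Measure (E d) => m univ) hπ.1
  simpa [Measure.map_apply measurable_fst MeasurableSet.univ] using h

theorem W2_self {d : ℕ} (μ : P2 d) : W2 μ μ = 0 := by
  refine le_antisymm (W2_le_of_plan (π := μ.meas.map fun x => (x, x)) ⟨?_, ?_⟩ ?_) bot_le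
  · rw [Measure.map_map measurable_fst (by fun_prop)]; exact Measure.map_id
  · rw [Measure.map_map measurable_snd (by fun_prop)]; exact Measure.map_id
  · rw [lintegral_map (by fun_prop) (by fun_prop)]; simp

/-- The Dirac mass at the origin. -/
noncomputable def diracZero (d : ℕ) : P2 d :=
  ⟨⟨Measure.dirac 0, inferInstance⟩, by simp⟩

theorem lintegral_sq_lt_top {d : ℕ} (μ : P2 d) : ∫⁻ x, ‖x‖ₑ ^ 2 ∂μ.meas < ∞ := μ.2

theorem W2_diracZero_le {d : ℕ} (μ : P2 d) {r : ℝ≥0∞} (h : ∫⁻ x, ‖x‖ₑ ^ 2 ∂μ.meas ≤ r ^ 2) :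
    W2 (diracZero d) μ ≤ r := by
  refine W2_le_of_plan (π := μ.meas.map fun x => (0, x)) ⟨?_, ?_⟩ ?_
  · rw [Measure.map_map measurable_fst (by fun_prop)]
    have : (Prod.fst ∘ fun x : E d => ((0 : E d), x)) = fun _ => 0 := rfl
    rw [this, Measure.map_const]; simp [diracZero, P2.meas]
  · rw [Measure.map_map measurable_snd (by fun_prop)]; exact Measure.map_id
  · rw [lintegral_map (by fun_prop) (by fun_prop)]
    refine le_trans (le_of_eq (lintegral_congr fun x => ?_)) h; rw [edist_zero_left]; rfl

theorem enorm_add_sq_le {G : Type*} [SeminormedAddCommGroup G] (x y : G) :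
    ‖x + y‖ₑ ^ 2 ≤ 2 * ‖x‖ₑ ^ 2 + 2 * ‖y‖ₑ ^ 2 := by
  rw [← ofReal_norm, ← ofReal_norm, ← ofReal_norm]
  rw [← ENNReal.ofReal_pow (norm_nonneg _), ← ENNReal.ofReal_pow (norm_nonneg _),
    ← ENNReal.ofReal_pow (norm_nonneg _), show (2 : ℝ≥0∞) = ENNReal.ofReal 2 by simp,
    ← ENNReal.ofReal_mul (by norm_num), ← ENNReal.ofReal_mul (by norm_num),
    ← ENNReal.ofReal_add (by positivity) (by positivity)]
  refine ENNReal.ofReal_le_ofReal ?_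
  have := norm_add_le x y
  nlinarith [norm_nonneg x, norm_nonneg y, norm_nonneg (x + y), sq_nonneg (‖x‖ - ‖y‖)]

theorem lintegral_sq_le_of_W2_lt {d : ℕ} {μ ν : P2 d} {r : ℝ≥0∞} (h : W2 μ ν < r) :
    ∫⁻ x, ‖x‖ₑ ^ 2 ∂μ.meas ≤ 2 * r ^ 2 + 2 * ∫⁻ x, ‖x‖ₑ ^ 2 ∂ν.meas := by
  obtain ⟨π, hπ, hc⟩ := exists_plan_of_W2_lt h
  rw [← hπ.1, ← hπ.2, lintegral_map (by fun_prop) (by fun_prop),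
    lintegral_map (by fun_prop) (by fun_prop)]
  calc ∫⁻ z, ‖z.1‖ₑ ^ 2 ∂π ≤ ∫⁻ z, (2 * edist z.1 z.2 ^ 2 + 2 * ‖z.2‖ₑ ^ 2) ∂π := by
        refine lintegral_mono fun z => ?_
        have := enorm_add_sq_le (z.1 - z.2) z.2
        rwa [sub_add_cancel, ← edist_eq_enorm_sub] at this
    _ = 2 * ∫⁻ z, edist z.1 z.2 ^ 2 ∂π + 2 * ∫⁻ z, ‖z.2‖ₑ ^ 2 ∂π := by
        rw [lintegral_add_left (by fun_prop), lintegral_const_mul _ (by fun_prop),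
          lintegral_const_mul _ (by fun_prop)]
    _ ≤ _ := by gcongr

/-! ### Semiconcave functions -/

/-- At distances of at least one the oscillation bound `2 ‖φ‖` suffices. At a shorter distance `t`,
the segment from `x` through `y` is prolonged to unit length; `y` is then a convex combination with
weight `t` on the far endpoint, and semiconcavity bounds the loss by `t` times the oscillation plus
`C`. -/
theorem SemiconcaveWith.lipschitz {d : ℕ} {φ : E d →ᵇ ℝ} {C : ℝ} (hC : 0 ≤ C)
    (h : SemiconcaveWith φ C) (x y : E d) : φ x - φ y ≤ (2 * ‖φ‖ + C) * ‖x - y‖ := by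
  have hb : ∀ a b : E d, φ a - φ b ≤ 2 * ‖φ‖ := fun a b => by
    have h1 := φ.norm_coe_le_norm a
    have h2 := φ.norm_coe_le_norm b
    rw [Real.norm_eq_abs] at h1 h2
    linarith [le_abs_self (φ a), neg_abs_le (φ b)]
  have hφ0 := norm_nonneg φ
  rcases le_or_gt 1 ‖x - y‖ with h1 | h1
  · have := hb x y
    nlinarith
  rcases eq_or_ne x y with rfl | hxy
  · simp
  set t := ‖x - y‖ with ht
  have ht0 : 0 < t := norm_pos_iff.2 (sub_ne_zero.2 hxy)
  have key := h x (x + t⁻¹ • (y - x)) t ⟨ht0.le, h1.le⟩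
  have e1 : (1 - t) • x + t • (x + t⁻¹ • (y - x)) = y := by
    rw [smul_add, smul_smul, mul_inv_cancel₀ ht0.ne', sub_smul, one_smul, one_smul]; abel
  have e2 : ‖x - (x + t⁻¹ • (y - x))‖ = 1 := by
    rw [sub_add_cancel_left, norm_neg, norm_smul, norm_sub_rev, ← ht, norm_inv, norm_norm,
      inv_mul_cancel₀ ht0.ne']
  rw [e1, e2] at key
  have := hb x (x + t⁻¹ • (y - x))
  nlinarith [mul_nonneg hC (mul_nonneg ht0.le ht0.le)]

/-- The local inequality is applied at `x + t (y - x)` and compared with semiconcavity on the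
segment. After division by `t`, the unknown local constant `c` carries a factor `t` and disappears
as `t → 0`. -/
theorem SemiconcaveWith.le_of_mem_proxSuperdiff {d : ℕ} {φ : E d → ℝ} {C : ℝ}
    (h : SemiconcaveWith φ C) {x ξ : E d} (hξ : ξ ∈ proxSuperdiff φ x) (y : E d) :
    φ y - φ x ≤ inner ℝ ξ (y - x) + C * ‖y - x‖ ^ 2 := by
  obtain ⟨c, r, hr, hloc⟩ := hξ
  have hev : ∀ᶠ t in 𝓝[>] (0 : ℝ), φ y - φ x ≤ inner ℝ ξ (y - x) + c * t * ‖y - x‖ ^ 2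
      + C * (1 - t) * ‖y - x‖ ^ 2 := by
    have h1 : Tendsto (fun t : ℝ => t * ‖y - x‖) (𝓝[>] 0) (𝓝 0) := by
      have : Tendsto (fun t : ℝ => t * ‖y - x‖) (𝓝 0) (𝓝 (0 * ‖y - x‖)) :=
        (continuous_id.mul continuous_const).tendsto 0
      rw [zero_mul] at this
      exact this.mono_left nhdsWithin_le_nhds
    filter_upwards [h1.eventually (gt_mem_nhds hr), self_mem_nhdsWithin,
      nhdsWithin_le_nhds (gt_mem_nhds (zero_lt_one' ℝ))] with t ht ht0 ht1
    have ht0 : 0 < t := ht0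
    have e : (1 - t) • x + t • y - x = t • (y - x) := by
      rw [sub_smul, one_smul, smul_sub]; abel
    have en : ‖t • (y - x)‖ = t * ‖y - x‖ := by
      rw [norm_smul, Real.norm_of_nonneg ht0.le]
    have a := hloc ((1 - t) • x + t • y) (by rw [e, en]; exact ht)
    have b := h x y t ⟨ht0.le, ht1.le⟩
    rw [e, en, inner_smul_right] at a
    rw [norm_sub_rev x y] at b
    refine le_of_mul_le_mul_left ?_ ht0
    nlinarith
  have hlim : Tendsto (fun t : ℝ => inner ℝ ξ (y - x) + c * t * ‖y - x‖ ^ 2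
      + C * (1 - t) * ‖y - x‖ ^ 2) (𝓝[>] 0) (𝓝 (inner ℝ ξ (y - x) + C * ‖y - x‖ ^ 2)) := by
    have : Tendsto (fun t : ℝ => inner ℝ ξ (y - x) + c * t * ‖y - x‖ ^ 2
      + C * (1 - t) * ‖y - x‖ ^ 2) (𝓝 0) (𝓝 (inner ℝ ξ (y - x) + c * 0 * ‖y - x‖ ^ 2
      + C * (1 - 0) * ‖y - x‖ ^ 2)) := by
      refine Continuous.tendsto ?_ 0
      fun_prop
    simp only [mul_zero, zero_mul, add_zero, sub_zero, mul_one] at this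
    exact this.mono_left nhdsWithin_le_nhds
  exact ge_of_tendsto hlim hev

theorem abs_integral_sub_le_of_W2_lt {d : ℕ} {φ : E d →ᵇ ℝ} {C : ℝ} (hC : 0 ≤ C)
    (h : SemiconcaveWith φ C) {μ ν : P2 d} {δ : ℝ} (hδ : 0 < δ)
    (hW : W2 μ ν < ENNReal.ofReal δ) :
    |∫ x, φ x ∂μ.meas - ∫ x, φ x ∂ν.meas| ≤ (2 * ‖φ‖ + C) * δ := by
  obtain ⟨π, hπ, hc⟩ := exists_plan_of_W2_lt hW
  have := isProbabilityMeasure_of_mem_plans hπ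
  have hsq : ∫⁻ z : E d × E d, ENNReal.ofReal (‖z.1 - z.2‖ ^ 2) ∂π ≤ ENNReal.ofReal (δ ^ 2) := by
    rw [ENNReal.ofReal_pow hδ.le]
    refine le_trans (le_of_eq (lintegral_congr fun z => ?_)) hc.le
    rw [ENNReal.ofReal_pow (norm_nonneg _), ofReal_norm, edist_eq_enorm_sub]
  have hmeas : Continuous fun z : E d × E d => ‖z.1 - z.2‖ ^ 2 := by fun_prop
  have hint2 : Integrable (fun z : E d × E d => ‖z.1 - z.2‖ ^ 2) π := by
    refine ⟨hmeas.aestronglyMeasurable, ?_⟩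
    rw [hasFiniteIntegral_iff_ofReal (ae_of_all _ fun z => by positivity)]
    exact hsq.trans_lt ENNReal.ofReal_lt_top
  have hle2 : ∫ z : E d × E d, ‖z.1 - z.2‖ ^ 2 ∂π ≤ δ ^ 2 := by
    rw [integral_eq_lintegral_of_nonneg_ae (ae_of_all _ fun z => by positivity)
      hmeas.aestronglyMeasurable]
    exact ENNReal.toReal_le_of_le_ofReal (by positivity) hsq
  have hi1 : Integrable (fun z : E d × E d => φ z.1) π :=
    (BoundedContinuousFunction.integrable _ (φ.compContinuous ⟨Prod.fst, continuous_fst⟩))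
  have hi2 : Integrable (fun z : E d × E d => φ z.2) π :=
    (BoundedContinuousFunction.integrable _ (φ.compContinuous ⟨Prod.snd, continuous_snd⟩))
  rw [← hπ.1, ← hπ.2, integral_map (by fun_prop) φ.continuous.aestronglyMeasurable,
    integral_map (by fun_prop) φ.continuous.aestronglyMeasurable, ← integral_sub hi1 hi2]
  set Λ := 2 * ‖φ‖ + C
  have hΛ : 0 ≤ Λ := by positivity
  calc |∫ z, (φ z.1 - φ z.2) ∂π|
      ≤ ∫ z : E d × E d, (Λ * (δ / 2) + Λ / (2 * δ) * ‖z.1 - z.2‖ ^ 2) ∂π := by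
        rw [← Real.norm_eq_abs]
        refine norm_integral_le_of_norm_le ((integrable_const _).add (hint2.const_mul _))
          (ae_of_all _ fun z => ?_)
        have hl : ‖φ z.1 - φ z.2‖ ≤ Λ * ‖z.1 - z.2‖ := by
          have h1 := h.lipschitz hC z.1 z.2
          have h2 := h.lipschitz hC z.2 z.1
          rw [norm_sub_rev] at h2
          exact abs_sub_le_iff.2 ⟨h1, h2⟩
        refine hl.trans ?_
        -- Young's inequality tuned to `δ`: against a plan of cost at most `δ ^ 2` the two terms
        -- contribute `δ / 2` each.
        have : ‖z.1 - z.2‖ ≤ δ / 2 + 1 / (2 * δ) * ‖z.1 - z.2‖ ^ 2 := by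
          field_simp
          nlinarith [sq_nonneg (‖z.1 - z.2‖ - δ)]
        calc Λ * ‖z.1 - z.2‖ ≤ Λ * (δ / 2 + 1 / (2 * δ) * ‖z.1 - z.2‖ ^ 2) := by gcongr
          _ = _ := by ring
    _ = Λ * (δ / 2) + Λ / (2 * δ) * ∫ z : E d × E d, ‖z.1 - z.2‖ ^ 2 ∂π := by
        rw [integral_add (integrable_const _) (hint2.const_mul _)]; simp [integral_const_mul]
    _ ≤ Λ * (δ / 2) + Λ / (2 * δ) * δ ^ 2 := by gcongr
    _ = Λ * δ := by field_simp; ring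

/-! ### Couplings adapted to a decomposition -/

section Coupling

variable {X : Type*} [MeasurableSpace X]

/-- A plan between parts of two measures is completed by the product of the remainders. -/
theorem map_add_prod_remainder {κ : Measure (X × X)} {μ ν ρ₁ ρ₂ : Measure X}
    [IsFiniteMeasure ρ₁] [IsFiniteMeasure ρ₂]
    (h₁ : κ.map Prod.fst + ρ₁ = μ) (h₂ : κ.map Prod.snd + ρ₂ = ν) (h : ρ₁ univ = ρ₂ univ) :
    (κ + (ρ₁ univ)⁻¹ • ρ₁.prod ρ₂).map Prod.fst = μ ∧
      (κ + (ρ₁ univ)⁻¹ • ρ₁.prod ρ₂).map Prod.snd = ν := by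
  rcases eq_or_ne (ρ₁ univ) 0 with h0 | h0
  · have e1 : ρ₁ = 0 := Measure.measure_univ_eq_zero.1 h0
    have e2 : ρ₂ = 0 := Measure.measure_univ_eq_zero.1 (h ▸ h0)
    subst e1 e2
    rw [add_zero] at h₁ h₂
    simpa using ⟨h₁, h₂⟩
  · have hc : (ρ₁ univ)⁻¹ * ρ₁ univ = 1 := ENNReal.inv_mul_cancel h0 (measure_ne_top _ _)
    constructor
    · rw [Measure.map_add _ _ measurable_fst, Measure.map_smul, Measure.map_fst_prod, ← h,
        smul_smul, hc, one_smul, h₁]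
    · rw [Measure.map_add _ _ measurable_snd, Measure.map_smul, Measure.map_snd_prod,
        smul_smul, hc, one_smul, h₂]

theorem mul_inv_max_le_one (a b : ℝ≥0∞) : (max a b)⁻¹ * a ≤ 1 := by
  rw [mul_comm, ← div_eq_mul_inv]
  exact ENNReal.div_le_of_le_mul (by rw [one_mul]; exact le_max_left _ _)

/-- For parts `m`, `n` of masses `a`, `b` the plan `(max a b)⁻¹ • m.prod n` moves mass `min a b`.
This is the mass of `m` that it leaves behind; the truncated subtraction is what makes it small when
`a` and `b` are close. -/
theorem one_sub_mul_inv_max_mul (a b : ℝ≥0∞) (ha : a ≠ ∞) (hb : b ≠ ∞) :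
    (1 - (max a b)⁻¹ * b) * a = a - b := by
  rcases le_total a b with h | h
  · rw [max_eq_right h, tsub_eq_zero_of_le h]
    rcases eq_or_ne b 0 with rfl | hb0
    · simp [le_antisymm h bot_le]
    · rw [ENNReal.inv_mul_cancel hb0 hb]; simp
  · rw [max_eq_left h, ENNReal.sub_mul (fun _ _ => ha), one_mul]
    rcases eq_or_ne a 0 with rfl | ha0
    · simp
    · rw [mul_right_comm, ENNReal.inv_mul_cancel ha0 ha, one_mul]

end Coupling

/-- Within each cell as much mass as possible is coupled, at cost at most `δ ^ 2`. What remains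
consists of the two tails `m₀`, `n₀` and the mass mismatches of the cells. It is coupled by a
normalized product, whose cost is controlled by second moments alone. -/
theorem exists_plan_of_decomposition {d : ℕ} {ι : Type*} [Fintype ι] {μ ν m₀ n₀ : Measure (E d)}
    [IsProbabilityMeasure μ] [IsProbabilityMeasure ν] {m n : ι → Measure (E d)}
    (hμ : μ = m₀ + ∑ j, m j) (hν : ν = n₀ + ∑ j, n j) {A : ι → Set (E d)} {δ R : ℝ≥0∞}
    (hm : ∀ j, ∀ᵐ x ∂m j, x ∈ A j) (hn : ∀ j, ∀ᵐ x ∂n j, x ∈ A j)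
    (hA : ∀ j, ∀ x ∈ A j, ∀ y ∈ A j, edist x y ≤ δ) (hR : ∀ j, ∀ x ∈ A j, ‖x‖ₑ ≤ R) :
    ∃ π ∈ plans μ ν, ∫⁻ z, edist z.1 z.2 ^ 2 ∂π ≤ δ ^ 2
      + 2 * (∫⁻ x, ‖x‖ₑ ^ 2 ∂m₀ + R ^ 2 * ∑ j, (m j univ - n j univ))
      + 2 * (∫⁻ x, ‖x‖ₑ ^ 2 ∂n₀ + R ^ 2 * ∑ j, (n j univ - m j univ)) := by
  classical
  have hmle : ∀ j, m j ≤ μ := fun j => by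
    rw [hμ]
    exact (Finset.single_le_sum (f := m) (fun i _ => Measure.zero_le _)
      (Finset.mem_univ j)).trans (Measure.le_add_left le_rfl)
  have hnle : ∀ j, n j ≤ ν := fun j => by
    rw [hν]
    exact (Finset.single_le_sum (f := n) (fun i _ => Measure.zero_le _)
      (Finset.mem_univ j)).trans (Measure.le_add_left le_rfl)
  have : ∀ j, IsFiniteMeasure (m j) := fun j => isFiniteMeasure_of_le μ (hmle j)
  have : ∀ j, IsFiniteMeasure (n j) := fun j => isFiniteMeasure_of_le ν (hnle j)
  have : IsFiniteMeasure m₀ := isFiniteMeasure_of_le μ (by rw [hμ]; exact Measure.le_add_right le_rfl)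
  have : IsFiniteMeasure n₀ := isFiniteMeasure_of_le ν (by rw [hν]; exact Measure.le_add_right le_rfl)
  set a : ι → ℝ≥0∞ := fun j => m j univ with ha
  set b : ι → ℝ≥0∞ := fun j => n j univ with hb
  have hat : ∀ j, a j ≠ ∞ := fun j => measure_ne_top _ _
  have hbt : ∀ j, b j ≠ ∞ := fun j => measure_ne_top _ _
  set c : ι → ℝ≥0∞ := fun j => (max (a j) (b j))⁻¹ with hc
  have hca : ∀ j, c j * a j ≤ 1 := fun j => mul_inv_max_le_one _ _
  have hcb : ∀ j, c j * b j ≤ 1 := fun j => by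
    have := mul_inv_max_le_one (b j) (a j)
    rwa [max_comm] at this
  set κ : Measure (E d × E d) := ∑ j, c j • (m j).prod (n j) with hκ
  set ρ₁ : Measure (E d) := m₀ + ∑ j, (1 - c j * b j) • m j with hρ₁
  set ρ₂ : Measure (E d) := n₀ + ∑ j, (1 - c j * a j) • n j with hρ₂
  have hone : ∀ (t : ℝ≥0∞) (q : Measure (E d)), t ≤ 1 → t • q + (1 - t) • q = q := by
    intro t q ht
    rw [← add_smul, add_tsub_cancel_of_le ht, one_smul]
  have hfst : κ.map Prod.fst + ρ₁ = μ := by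
    have : κ.map Prod.fst = ∑ j, (c j * b j) • m j := by
      rw [hκ, ← Measure.mapₗ_apply_of_measurable measurable_fst, map_sum]
      refine Finset.sum_congr rfl fun j _ => ?_
      rw [Measure.mapₗ_apply_of_measurable measurable_fst, Measure.map_smul,
        Measure.map_fst_prod, smul_smul]
    rw [this, hρ₁, hμ, add_left_comm, ← Finset.sum_add_distrib]
    congr 1
    exact Finset.sum_congr rfl fun j _ => hone _ _ (hcb j)
  have hsnd : κ.map Prod.snd + ρ₂ = ν := by
    have : κ.map Prod.snd = ∑ j, (c j * a j) • n j := by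
      rw [hκ, ← Measure.mapₗ_apply_of_measurable measurable_snd, map_sum]
      refine Finset.sum_congr rfl fun j _ => ?_
      rw [Measure.mapₗ_apply_of_measurable measurable_snd, Measure.map_smul,
        Measure.map_snd_prod, smul_smul]
    rw [this, hρ₂, hν, add_left_comm, ← Finset.sum_add_distrib]
    congr 1
    exact Finset.sum_congr rfl fun j _ => hone _ _ (hca j)
  have hρ₁le : ρ₁ ≤ μ := hfst ▸ Measure.le_add_left le_rfl
  have hρ₂le : ρ₂ ≤ ν := hsnd ▸ Measure.le_add_left le_rfl
  have : IsFiniteMeasure ρ₁ := isFiniteMeasure_of_le μ hρ₁le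
  have : IsFiniteMeasure ρ₂ := isFiniteMeasure_of_le ν hρ₂le
  have hκle : κ.map Prod.fst ≤ μ := hfst ▸ Measure.le_add_right le_rfl
  have hκu : κ univ ≤ 1 := by
    have := hκle univ
    rwa [Measure.map_apply measurable_fst MeasurableSet.univ, preimage_univ,
      measure_univ (μ := μ)] at this
  have hκu' : κ univ ≠ ∞ := (hκu.trans_lt ENNReal.one_lt_top).ne
  have hmass : ρ₁ univ = ρ₂ univ := by
    have h1 := congrArg (fun q : Measure (E d) => q univ) hfst
    have h2 := congrArg (fun q : Measure (E d) => q univ) hsnd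
    simp only [Measure.add_apply, Measure.map_apply measurable_fst MeasurableSet.univ,
      Measure.map_apply measurable_snd MeasurableSet.univ, preimage_univ, measure_univ] at h1 h2
    -- Both remainders complete the same finite mass of `κ` to one, so they have equal mass.
    exact (ENNReal.add_right_inj hκu').1 (h1.trans h2.symm)
  obtain ⟨hp1, hp2⟩ := map_add_prod_remainder hfst hsnd hmass
  refine ⟨_, ⟨hp1, hp2⟩, ?_⟩
  have hd : Measurable fun z : E d × E d => edist z.1 z.2 ^ 2 := by fun_prop
  have hs : Measurable fun z : E d => ‖z‖ₑ ^ 2 := by fun_prop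
  have hκcost : ∫⁻ z, edist z.1 z.2 ^ 2 ∂κ ≤ δ ^ 2 := by
    have hae : ∀ᵐ z ∂κ, edist z.1 z.2 ^ 2 ≤ δ ^ 2 := by
      rw [hκ, ae_iff, Measure.finsetSum_apply, Finset.sum_eq_zero_iff]
      intro j _
      have h1 : ∀ᵐ z ∂(m j).prod (n j), z.1 ∈ A j := Measure.quasiMeasurePreserving_fst.ae (hm j)
      have h2 : ∀ᵐ z ∂(m j).prod (n j), z.2 ∈ A j := Measure.quasiMeasurePreserving_snd.ae (hn j)
      have h3 : ∀ᵐ z ∂(m j).prod (n j), edist z.1 z.2 ^ 2 ≤ δ ^ 2 := by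
        filter_upwards [h1, h2] with z hz1 hz2
        gcongr
        exact hA j _ hz1 _ hz2
      rw [Measure.smul_apply, smul_eq_mul, ae_iff.1 h3, mul_zero]
    calc ∫⁻ z, edist z.1 z.2 ^ 2 ∂κ ≤ ∫⁻ _, δ ^ 2 ∂κ := lintegral_mono_ae hae
      _ = δ ^ 2 * κ univ := lintegral_const _
      _ ≤ δ ^ 2 * 1 := by gcongr
      _ = δ ^ 2 := mul_one _
  have hbd : ∀ j, ∀ q : Measure (E d), (∀ᵐ x ∂q, x ∈ A j) →
      ∫⁻ x, ‖x‖ₑ ^ 2 ∂q ≤ R ^ 2 * q univ := by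
    intro j q hq
    rw [← lintegral_const]
    refine lintegral_mono_ae ?_
    filter_upwards [hq] with x hx
    gcongr
    exact hR j x hx
  have hρ₁m : ∫⁻ x, ‖x‖ₑ ^ 2 ∂ρ₁ ≤ ∫⁻ x, ‖x‖ₑ ^ 2 ∂m₀ + R ^ 2 * ∑ j, (a j - b j) := by
    rw [hρ₁, lintegral_add_measure, lintegral_finsetSum_measure, Finset.mul_sum]
    gcongr with j
    rw [lintegral_smul_measure, smul_eq_mul, ← one_sub_mul_inv_max_mul _ _ (hat j) (hbt j),
      mul_left_comm]
    gcongr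
    exact hbd j _ (hm j)
  have hρ₂m : ∫⁻ x, ‖x‖ₑ ^ 2 ∂ρ₂ ≤ ∫⁻ x, ‖x‖ₑ ^ 2 ∂n₀ + R ^ 2 * ∑ j, (b j - a j) := by
    rw [hρ₂, lintegral_add_measure, lintegral_finsetSum_measure, Finset.mul_sum]
    gcongr with j
    rw [lintegral_smul_measure, smul_eq_mul, ← one_sub_mul_inv_max_mul _ _ (hbt j) (hat j),
      mul_left_comm, max_comm]
    gcongr
    exact hbd j _ (hn j)
  have hrest : (ρ₁ univ)⁻¹ * ∫⁻ z, edist z.1 z.2 ^ 2 ∂ρ₁.prod ρ₂ ≤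
      2 * ∫⁻ x, ‖x‖ₑ ^ 2 ∂ρ₁ + 2 * ∫⁻ x, ‖x‖ₑ ^ 2 ∂ρ₂ := by
    have h1 : ∫⁻ z : E d × E d, ‖z.1‖ₑ ^ 2 ∂ρ₁.prod ρ₂ = ρ₁ univ * ∫⁻ x, ‖x‖ₑ ^ 2 ∂ρ₁ := by
      rw [← lintegral_map (f := fun x : E d => ‖x‖ₑ ^ 2) hs measurable_fst, Measure.map_fst_prod,
        lintegral_smul_measure, smul_eq_mul, hmass]
    have h2 : ∫⁻ z : E d × E d, ‖z.2‖ₑ ^ 2 ∂ρ₁.prod ρ₂ = ρ₁ univ * ∫⁻ x, ‖x‖ₑ ^ 2 ∂ρ₂ := by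
      rw [← lintegral_map (f := fun x : E d => ‖x‖ₑ ^ 2) hs measurable_snd, Measure.map_snd_prod,
        lintegral_smul_measure, smul_eq_mul]
    calc (ρ₁ univ)⁻¹ * ∫⁻ z, edist z.1 z.2 ^ 2 ∂ρ₁.prod ρ₂
        ≤ (ρ₁ univ)⁻¹ * ∫⁻ z : E d × E d, (2 * ‖z.1‖ₑ ^ 2 + 2 * ‖z.2‖ₑ ^ 2) ∂ρ₁.prod ρ₂ := by
          gcongr with z
          have := enorm_add_sq_le z.1 (-z.2)
          rwa [← sub_eq_add_neg, ← edist_eq_enorm_sub, enorm_neg] at this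
      _ = (ρ₁ univ)⁻¹ * ρ₁ univ * (2 * ∫⁻ x, ‖x‖ₑ ^ 2 ∂ρ₁ + 2 * ∫⁻ x, ‖x‖ₑ ^ 2 ∂ρ₂) := by
          rw [lintegral_add_left (by fun_prop), lintegral_const_mul _ (by fun_prop),
            lintegral_const_mul _ (by fun_prop), h1, h2]
          ring
      _ ≤ 1 * _ := by gcongr; exact ENNReal.inv_mul_le_one _
      _ = _ := one_mul _
  rw [lintegral_add_measure, lintegral_smul_measure, smul_eq_mul, add_assoc]
  exact add_le_add hκcost (hrest.trans (by gcongr))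

/-! ### Convergence in `W2` from test functions and uniform tails -/

theorem exists_partition_closedBall (d : ℕ) (R : ℝ) {δ : ℝ} (hδ : 0 < δ) :
    ∃ (n : ℕ) (χ : Fin n → E d → ℝ), (∀ j, ContDiff ℝ 1 (χ j)) ∧ (∀ j, HasCompactSupport (χ j)) ∧
      (∀ j x, 0 ≤ χ j x) ∧ (∀ x, ∑ j, χ j x ≤ 1) ∧ (∀ x, ‖x‖ ≤ R → ∑ j, χ j x = 1) ∧
      (∀ j x y, χ j x ≠ 0 → χ j y ≠ 0 → dist x y ≤ δ) ∧ ∀ j x, χ j x ≠ 0 → ‖x‖ ≤ R + δ := by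
  obtain ⟨t, ht, htf, hcov⟩ :=
    (isCompact_closedBall (0 : E d) R).finite_cover_balls (e := δ / 4) (by positivity)
  obtain ⟨n, p, hp⟩ : ∃ (n : ℕ) (p : Fin n → E d), range p = t := by
    obtain ⟨n, e, -, he⟩ := htf.fin_param
    exact ⟨n, e, he⟩
  let f : (j : Fin n) → ContDiffBump (p j) := fun j =>
    ⟨δ / 4, δ / 2, by positivity, by linarith⟩
  have hf1 : ∀ j x, f j x ≤ 1 := fun j x => (f j).le_one
  have hf0 : ∀ j x, 0 ≤ f j x := fun j x => (f j).nonneg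
  -- The ordered products telescope, so the sum is one wherever some bump equals one, in particular
  -- on the ball; no division is needed.
  have hsum : ∀ x, ∑ j, f j x * ∏ i with i < j, (1 - f i x) = 1 - ∏ i, (1 - f i x) := fun x => by
    rw [Finset.prod_one_sub_ordered]; ring
  have hball : ∀ j x, f j x * ∏ i with i < j, (1 - f i x) ≠ 0 → dist x (p j) < δ / 2 := by
    intro j x h
    have : x ∈ Function.support (f j) := left_ne_zero_of_mul h
    rw [(f j).support_eq] at this
    exact this
  refine ⟨n, fun j x => f j x * ∏ i with i < j, (1 - f i x), fun j => ?_, fun j => ?_,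
    fun j x => ?_, fun x => ?_, fun x hx => ?_, fun j x y hx hy => ?_, fun j x hx => ?_⟩
  · exact (f j).contDiff.mul (contDiff_prod fun i _ => contDiff_const.sub (f i).contDiff)
  · exact (f j).hasCompactSupport.mul_right
  · exact mul_nonneg (hf0 j x) (Finset.prod_nonneg fun i _ => sub_nonneg.2 (hf1 i x))
  · rw [hsum, sub_le_self_iff]
    exact Finset.prod_nonneg fun i _ => sub_nonneg.2 (hf1 i x)
  · rw [hsum, sub_eq_self]
    obtain ⟨q, hq, hxq⟩ := mem_iUnion₂.1 (hcov (mem_closedBall_zero_iff.2 hx))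
    rw [← hp] at hq
    obtain ⟨j, rfl⟩ := hq
    refine Finset.prod_eq_zero (Finset.mem_univ j) ?_
    rw [(f j).one_of_mem_closedBall (Metric.ball_subset_closedBall hxq), sub_self]
  · have h1 := hball j x hx
    have h2 := hball j y hy
    linarith [dist_triangle_right x y (p j)]
  · have h1 := hball j x hx
    have h2 : p j ∈ Metric.closedBall (0 : E d) R := ht (hp ▸ mem_range_self j)
    rw [mem_closedBall_zero_iff] at h2
    rw [dist_eq_norm] at h1
    have := norm_le_norm_add_norm_sub' x (p j)
    linarith

theorem eq_withDensity_add_sum {d : ℕ} {n : ℕ} (μ : Measure (E d)) {χ : Fin n → E d → ℝ}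
    (hc : ∀ j, Continuous (χ j)) (h0 : ∀ j x, 0 ≤ χ j x) (h1 : ∀ x, ∑ j, χ j x ≤ 1) :
    μ = μ.withDensity (fun x => ENNReal.ofReal (1 - ∑ j, χ j x)) +
      ∑ j, μ.withDensity (fun x => ENNReal.ofReal (χ j x)) := by
  have hm : ∀ j, Measurable fun x => ENNReal.ofReal (χ j x) := fun j =>
    (hc j).measurable.ennreal_ofReal
  ext s hs
  rw [Measure.add_apply, Measure.finsetSum_apply, withDensity_apply _ hs]
  simp only [withDensity_apply _ hs]
  rw [← lintegral_finsetSum _ fun j _ => hm j,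
    ← lintegral_add_right _ (Finset.measurable_sum _ fun j _ => hm j), ← setLIntegral_one]
  refine lintegral_congr fun x => ?_
  rw [← ENNReal.ofReal_sum_of_nonneg fun j _ => h0 j x,
    ← ENNReal.ofReal_add (sub_nonneg.2 (h1 x)) (Finset.sum_nonneg fun j _ => h0 j x)]
  simp

theorem exists_tail_le {d : ℕ} (ν : P2 d) {e : ℝ≥0∞} (he : 0 < e) :
    ∃ R₀ : ℝ, ∀ R, R₀ ≤ R → ∫⁻ x in {x | R < ‖x‖}, ‖x‖ₑ ^ 2 ∂ν.meas ≤ e := by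
  have hlim : Tendsto (fun n : ℕ => ∫⁻ x in {x : E d | (n : ℝ) < ‖x‖}, ‖x‖ₑ ^ 2 ∂ν.meas)
      atTop (𝓝 0) := by
    refine tendsto_setLIntegral_zero (lintegral_sq_lt_top ν).ne ?_
    have := tendsto_measure_iInter_atTop (μ := ν.meas) (s := fun n : ℕ => {x : E d | (n : ℝ) < ‖x‖})
      (fun n => (measurableSet_lt measurable_const measurable_norm).nullMeasurableSet)
      (fun a b hab x (hx : (b : ℝ) < ‖x‖) =>
        show (a : ℝ) < ‖x‖ from lt_of_le_of_lt (Nat.cast_le.2 hab) hx) ⟨0, measure_ne_top _ _⟩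
    have he : ⋂ n : ℕ, {x : E d | (n : ℝ) < ‖x‖} = ∅ := by
      ext x
      simp only [mem_iInter, mem_ofPred_eq, mem_empty_iff_false, iff_false, not_forall, not_lt]
      exact exists_nat_ge _
    rwa [he, measure_empty] at this
  obtain ⟨N, hN⟩ := (hlim.eventually (gt_mem_nhds he)).exists
  refine ⟨N, fun R hR => le_trans (lintegral_mono_set fun x hx => ?_) hN.le⟩
  exact lt_of_le_of_lt hR hx

/-- A smooth partition of a large ball cuts both measures into small cells. The cell masses are
integrals of finitely many test functions, hence converge, and the parts outside the ball are
controlled by the tails. -/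
theorem tendsto_W2_of_tail {d : ℕ} {ι : Type*} {l : Filter ι} {c : ι → P2 d} {ν : P2 d}
    (htest : ∀ ψ : E d → ℝ, ContDiff ℝ 1 ψ → HasCompactSupport ψ →
      Tendsto (fun i => ∫ x, ψ x ∂(c i).meas) l (𝓝 (∫ x, ψ x ∂ν.meas)))
    (htail : ∀ e : ℝ≥0∞, 0 < e → ∃ R₀ : ℝ, ∀ R, R₀ ≤ R →
      ∀ᶠ i in l, ∫⁻ x in {x | R < ‖x‖}, ‖x‖ₑ ^ 2 ∂(c i).meas ≤ e) :
    Tendsto (fun i => W2 (c i) ν) l (𝓝 0) := by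
  rw [ENNReal.tendsto_nhds_zero]
  intro r hr
  -- The final count is `δ²` for the cells, `4 δ²` for the tails and `δ²` for the mass mismatches.
  -- Rounding six up to the square nine allows `δ = r / 3`.
  obtain ⟨δ, hδ, hδr⟩ : ∃ δ : ℝ, 0 < δ ∧ 9 * ENNReal.ofReal δ ^ 2 ≤ r ^ 2 := by
    rcases eq_or_ne r ∞ with rfl | hrt
    · exact ⟨1, one_pos, by simp⟩
    · refine ⟨r.toReal / 3, by have := ENNReal.toReal_pos hr.ne' hrt; positivity, ?_⟩
      rw [ENNReal.ofReal_div_of_pos (by norm_num), ENNReal.ofReal_toReal hrt,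
        show (9 : ℝ≥0∞) = ENNReal.ofReal 3 ^ 2 by
          rw [← ENNReal.ofReal_pow (by norm_num)]; norm_num,
        ← mul_pow, ENNReal.mul_div_cancel (by simp) (by simp)]
  have he : 0 < ENNReal.ofReal δ ^ 2 := 
    pos_iff_ne_zero.2 (pow_ne_zero 2 (ENNReal.ofReal_pos.2 hδ).ne')
  set e := ENNReal.ofReal δ ^ 2 with hedef
  obtain ⟨R₁, hR₁⟩ := htail e he
  obtain ⟨R₂, hR₂⟩ := exists_tail_le ν he
  set R := max R₁ R₂
  have hT1 := hR₁ R (le_max_left _ _)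
  have hT2 := hR₂ R (le_max_right _ _)
  obtain ⟨n, χ, hχd, hχc, hχ0, hχ1, hχR, hχδ, hχb⟩ := exists_partition_closedBall d R hδ
  have hχle : ∀ j x, χ j x ≤ 1 := fun j x =>
    (Finset.single_le_sum (f := fun j => χ j x) (fun i _ => hχ0 i x) (Finset.mem_univ j)).trans
      (hχ1 x)
  have hχi : ∀ (j) (μ : P2 d), Integrable (χ j) μ.meas := fun j μ =>
    (hχd j).continuous.integrable_of_hasCompactSupport (hχc j)
  have hmass : ∀ (j) (μ : P2 d), (μ.meas.withDensity fun x => ENNReal.ofReal (χ j x)) univ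
      = ENNReal.ofReal (∫ x, χ j x ∂μ.meas) := fun j μ => by
    rw [withDensity_apply _ MeasurableSet.univ, Measure.restrict_univ,
      ofReal_integral_eq_lintegral_ofReal (hχi j μ) (ae_of_all _ fun x => hχ0 j x)]
  have hmoment : ∀ μ : P2 d,
      ∫⁻ x, ‖x‖ₑ ^ 2 ∂(μ.meas.withDensity fun x => ENNReal.ofReal (1 - ∑ j, χ j x)) ≤
        ∫⁻ x in {x | R < ‖x‖}, ‖x‖ₑ ^ 2 ∂μ.meas := fun μ => by
    rw [lintegral_withDensity_eq_lintegral_mul _ (Continuous.measurable (by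
      have := fun j => (hχd j).continuous
      fun_prop)).ennreal_ofReal (by fun_prop), ← lintegral_indicator
      (measurableSet_lt measurable_const measurable_norm)]
    refine lintegral_mono fun x => ?_
    by_cases hx : R < ‖x‖
    · rw [indicator_of_mem (by exact hx)]
      have : ENNReal.ofReal (1 - ∑ j, χ j x) ≤ 1 := by
        rw [ENNReal.ofReal_le_one]
        linarith [Finset.sum_nonneg (s := Finset.univ) fun j _ => hχ0 j x]
      exact (mul_le_mul_left this _).trans (one_mul _).le
    · simp [hχR x (not_lt.1 hx)]
  have hA : ∀ (j) (μ : P2 d),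
      ∀ᵐ x ∂(μ.meas.withDensity fun x => ENNReal.ofReal (χ j x)), x ∈ {x | χ j x ≠ 0} := by
    intro j μ
    rw [ae_withDensity_iff (hχd j).continuous.measurable.ennreal_ofReal]
    exact ae_of_all _ fun x hx h0 => hx (by simp [h0])
  have hsub : Tendsto (fun i => (2 : ℝ≥0∞) * (ENNReal.ofReal (R + δ) ^ 2 *
      ∑ j, (ENNReal.ofReal (∫ x, χ j x ∂(c i).meas) - ENNReal.ofReal (∫ x, χ j x ∂ν.meas))) +
      2 * (ENNReal.ofReal (R + δ) ^ 2 *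
      ∑ j, (ENNReal.ofReal (∫ x, χ j x ∂ν.meas) - ENNReal.ofReal (∫ x, χ j x ∂(c i).meas))))
      l (𝓝 0) := by
    have hj : ∀ j, Tendsto (fun i => ENNReal.ofReal (∫ x, χ j x ∂(c i).meas)) l
        (𝓝 (ENNReal.ofReal (∫ x, χ j x ∂ν.meas))) := fun j =>
      ENNReal.tendsto_ofReal (htest _ (hχd j) (hχc j))
    have h1 : Tendsto (fun i => ∑ j, (ENNReal.ofReal (∫ x, χ j x ∂(c i).meas) -
        ENNReal.ofReal (∫ x, χ j x ∂ν.meas))) l (𝓝 (∑ _j : Fin n, 0)) :=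
      tendsto_finsetSum _ fun j _ => by
        have := ENNReal.Tendsto.sub (hj j)
          (tendsto_const_nhds (x := ENNReal.ofReal (∫ x, χ j x ∂ν.meas)))
          (Or.inl ENNReal.ofReal_ne_top)
        rwa [tsub_self] at this
    have h2 : Tendsto (fun i => ∑ j, (ENNReal.ofReal (∫ x, χ j x ∂ν.meas) -
        ENNReal.ofReal (∫ x, χ j x ∂(c i).meas))) l (𝓝 (∑ _j : Fin n, 0)) :=
      tendsto_finsetSum _ fun j _ => by
        have := ENNReal.Tendsto.sub
          (tendsto_const_nhds (x := ENNReal.ofReal (∫ x, χ j x ∂ν.meas))) (hj j)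
          (Or.inl ENNReal.ofReal_ne_top)
        rwa [tsub_self] at this
    rw [Finset.sum_const_zero] at h1 h2
    have hk : ENNReal.ofReal (R + δ) ^ 2 ≠ ∞ := by simp
    have h3 := ENNReal.Tendsto.const_mul (a := 2)
      (ENNReal.Tendsto.const_mul (a := ENNReal.ofReal (R + δ) ^ 2) h1 (Or.inr hk)) (Or.inr (by simp))
    have h4 := ENNReal.Tendsto.const_mul (a := 2)
      (ENNReal.Tendsto.const_mul (a := ENNReal.ofReal (R + δ) ^ 2) h2 (Or.inr hk)) (Or.inr (by simp))
    simpa using h3.add h4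
  filter_upwards [hT1, hsub.eventually (gt_mem_nhds he)] with i hi hs
  have hci := fun j => (hχd j).continuous
  obtain ⟨π, hπ, hcost⟩ := exists_plan_of_decomposition
    (eq_withDensity_add_sum (c i).meas hci hχ0 hχ1) (eq_withDensity_add_sum ν.meas hci hχ0 hχ1)
    (A := fun j => {x | χ j x ≠ 0}) (δ := ENNReal.ofReal δ) (R := ENNReal.ofReal (R + δ))
    (fun j => hA j _) (fun j => hA j _)
    (fun j x hx y hy => by
      rw [edist_dist]; exact ENNReal.ofReal_le_ofReal (hχδ j x y hx hy))
    (fun j x hx => by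
      rw [← ofReal_norm]; exact ENNReal.ofReal_le_ofReal (hχb j x hx))
  refine W2_le_of_plan hπ (hcost.trans (le_trans ?_ hδr))
  simp only [hmass]
  rw [mul_add, mul_add]
  have m1 := (hmoment (c i)).trans hi
  have m2 := (hmoment ν).trans hT2
  rw [← hedef]
  calc _ ≤ e + (2 * e + 2 * (ENNReal.ofReal (R + δ) ^ 2 * ∑ j,
        (ENNReal.ofReal (∫ x, χ j x ∂(c i).meas) - ENNReal.ofReal (∫ x, χ j x ∂ν.meas)))) +
        (2 * e + 2 * (ENNReal.ofReal (R + δ) ^ 2 * ∑ j,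
        (ENNReal.ofReal (∫ x, χ j x ∂ν.meas) - ENNReal.ofReal (∫ x, χ j x ∂(c i).meas)))) := by
        gcongr
    _ = 5 * e + (2 * (ENNReal.ofReal (R + δ) ^ 2 * ∑ j,
        (ENNReal.ofReal (∫ x, χ j x ∂(c i).meas) - ENNReal.ofReal (∫ x, χ j x ∂ν.meas))) +
        2 * (ENNReal.ofReal (R + δ) ^ 2 * ∑ j,
        (ENNReal.ofReal (∫ x, χ j x ∂ν.meas) - ENNReal.ofReal (∫ x, χ j x ∂(c i).meas)))) := by
        ring
    _ ≤ 5 * e + e := by gcongr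
    _ ≤ 9 * e := by
        rw [← add_one_mul]; gcongr; norm_num

/-! ### The moment `∫ (1 + |x|²) dμ` and its truncations -/

/-- The moment `∫ (1 + |x|²) dμ`. -/
noncomputable def moment {d : ℕ} (μ : P2 d) : ℝ := ∫ x, (1 + ‖x‖ ^ 2) ∂μ.meas

/-- A slowly varying smooth cutoff, equal to `1` where `ε log (1 + |x|²) ≤ 1` and to `0` where
`ε log (1 + |x|²) ≥ 2`. -/
noncomputable def cutoff {d : ℕ} (ε : ℝ) (x : E d) : ℝ :=
  Real.smoothTransition (2 - ε * Real.log (1 + ‖x‖ ^ 2))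

/-- The truncated weight. -/
noncomputable def truncWeight {d : ℕ} (ε : ℝ) (x : E d) : ℝ := (1 + ‖x‖ ^ 2) * cutoff ε x

/-- The part of the moment that the cutoff removes. -/
noncomputable def tailMoment {d : ℕ} (ε : ℝ) (μ : P2 d) : ℝ :=
  ∫ x, (1 + ‖x‖ ^ 2) * (1 - cutoff ε x) ∂μ.meas

section Cutoff

variable {d : ℕ}

theorem one_add_sq_pos (x : E d) : 0 < 1 + ‖x‖ ^ 2 := by positivity

theorem cutoff_nonneg (ε : ℝ) (x : E d) : 0 ≤ cutoff ε x := Real.smoothTransition.nonneg _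

theorem cutoff_le_one (ε : ℝ) (x : E d) : cutoff ε x ≤ 1 := Real.smoothTransition.le_one _

theorem log_one_add_sq_nonneg (x : E d) : 0 ≤ Real.log (1 + ‖x‖ ^ 2) :=
  Real.log_nonneg (by nlinarith [sq_nonneg ‖x‖])

theorem cutoff_anti {δ ε : ℝ} (h : δ ≤ ε) (x : E d) : cutoff ε x ≤ cutoff δ x := by
  refine Real.smoothTransition.monotone ?_
  have := mul_le_mul_of_nonneg_right h (log_one_add_sq_nonneg x)
  linarith

theorem cutoff_eq_zero {ε : ℝ} {x : E d} (h : 2 ≤ ε * Real.log (1 + ‖x‖ ^ 2)) :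
    cutoff ε x = 0 :=
  Real.smoothTransition.zero_of_nonpos (by linarith)

theorem contDiff_cutoff (ε : ℝ) : ContDiff ℝ 1 (cutoff ε : E d → ℝ) := by
  refine ContDiff.comp (g := Real.smoothTransition)
    (Real.smoothTransition.contDiff (n := (1 : ℕ∞))) ?_
  refine contDiff_const.sub (contDiff_const.mul (ContDiff.log ?_ fun x => (one_add_sq_pos x).ne'))
  exact contDiff_const.add (contDiff_norm_sq ℝ)

theorem hasCompactSupport_cutoff {ε : ℝ} (hε : 0 < ε) :
    HasCompactSupport (cutoff ε : E d → ℝ) := by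
  -- Beyond radius `exp (1 / ε)` one has `ε log (1 + |x|²) ≥ 2 ε log |x| ≥ 2`.
  refine HasCompactSupport.intro (isCompact_closedBall (0 : E d) (Real.exp (1 / ε))) fun x hx => ?_
  refine cutoff_eq_zero ?_
  rw [mem_closedBall_zero_iff, not_le] at hx
  have h1 : Real.log (Real.exp (1 / ε) ^ 2) ≤ Real.log (1 + ‖x‖ ^ 2) := by
    refine Real.log_le_log (by positivity) ?_
    have := Real.exp_pos (1 / ε)
    nlinarith
  rw [Real.log_pow, Real.log_exp] at h1
  have h2 := mul_le_mul_of_nonneg_left h1 hε.le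
  push_cast at h2
  rwa [mul_left_comm, mul_one_div_cancel hε.ne', mul_one] at h2

theorem contDiff_truncWeight (ε : ℝ) : ContDiff ℝ 1 (truncWeight ε : E d → ℝ) :=
  (contDiff_const.add (contDiff_norm_sq ℝ)).mul (contDiff_cutoff ε)

theorem hasCompactSupport_truncWeight {ε : ℝ} (hε : 0 < ε) :
    HasCompactSupport (truncWeight ε : E d → ℝ) :=
  (hasCompactSupport_cutoff hε).mul_left

/-- This is why the cutoff is logarithmic: differentiating `log (1 + |x|²)` produces a denominator
that cancels the weight, so the cutoff adds only a bounded multiple of `ε` to the coefficient of `2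
⟨x, y⟩`. Estimates based on it survive the removal of the cutoff. -/
theorem fderiv_truncWeight (ε : ℝ) (x y : E d) :
    fderiv ℝ (truncWeight ε) x y =
      (cutoff ε x - ε * deriv Real.smoothTransition (2 - ε * Real.log (1 + ‖x‖ ^ 2)))
        * (2 * inner ℝ x y) := by
  have hw : HasFDerivAt (fun x : E d => 1 + ‖x‖ ^ 2) (2 • innerSL ℝ x) x :=
    (hasStrictFDerivAt_norm_sq x).hasFDerivAt.const_add 1
  have hθ : HasDerivAt Real.smoothTransition
      (deriv Real.smoothTransition (2 - ε * Real.log (1 + ‖x‖ ^ 2)))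
      (2 - ε * Real.log (1 + ‖x‖ ^ 2)) :=
    ((Real.smoothTransition.contDiff (n := (1 : ℕ∞))).differentiable (by simp) _).hasDerivAt
  have hu := ((hw.log (one_add_sq_pos x).ne').const_mul ε).const_sub 2
  have hc := hθ.comp_hasFDerivAt x hu
  have hm := hw.mul hc
  have hm' : HasFDerivAt (truncWeight ε : E d → ℝ) _ x := hm
  rw [hm'.fderiv]
  have := (one_add_sq_pos x).ne'
  simp only [add_apply, smul_apply, smul_eq_mul,
    neg_apply, innerSL_apply_apply, Function.comp_apply, nsmul_eq_mul,
    cutoff]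
  field_simp
  push_cast
  ring

theorem exists_deriv_smoothTransition_le :
    ∃ C : ℝ, 0 ≤ C ∧ ∀ u, |deriv Real.smoothTransition u| ≤ C := by
  have hcont : Continuous (deriv Real.smoothTransition) :=
    (Real.smoothTransition.contDiff (n := (1 : ℕ∞))).continuous_deriv (by simp)
  have hsupp : HasCompactSupport (deriv Real.smoothTransition) := by
    refine HasCompactSupport.intro (isCompact_Icc (a := (0 : ℝ)) (b := 1)) fun u hu => ?_
    rw [mem_Icc, not_and_or, not_le, not_le] at hu
    rcases hu with hu | hu
    · have : Real.smoothTransition =ᶠ[𝓝 u] fun _ => 0 := by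
        filter_upwards [gt_mem_nhds hu] with z hz
        exact Real.smoothTransition.zero_of_nonpos (le_of_lt hz)
      rw [this.deriv_eq, deriv_const]
    · have : Real.smoothTransition =ᶠ[𝓝 u] fun _ => 1 := by
        filter_upwards [lt_mem_nhds hu] with z hz
        exact Real.smoothTransition.one_of_one_le (le_of_lt hz)
      rw [this.deriv_eq, deriv_const]
  obtain ⟨C, hC⟩ := hcont.bounded_above_of_compact_support hsupp
  exact ⟨C, (norm_nonneg _).trans (hC 0), hC⟩

theorem tendsto_cutoff (x : E d) :
    Tendsto (fun n : ℕ => cutoff (1 / ((n : ℝ) + 1)) x) atTop (𝓝 1) := by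
  have h := Tendsto.mul_const (Real.log (1 + ‖x‖ ^ 2)) (tendsto_one_div_add_atTop_nhds_zero_nat (𝕜 := ℝ))
  rw [zero_mul] at h
  refine tendsto_const_nhds.congr' ?_
  filter_upwards [h.eventually (gt_mem_nhds one_pos)] with n hn
  exact (Real.smoothTransition.one_of_one_le (by linarith)).symm

theorem integrable_weight (μ : P2 d) : Integrable (fun x => 1 + ‖x‖ ^ 2) μ.meas := by
  refine (integrable_const _).add ⟨by fun_prop, ?_⟩
  rw [hasFiniteIntegral_iff_ofReal (ae_of_all _ fun x => by positivity)]
  refine lt_of_le_of_lt (le_of_eq (lintegral_congr fun x => ?_)) (lintegral_sq_lt_top μ)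
  rw [ENNReal.ofReal_pow (norm_nonneg _), ofReal_norm]

theorem ofReal_moment (μ : P2 d) :
    ENNReal.ofReal (moment μ) = 1 + ∫⁻ x, ‖x‖ₑ ^ 2 ∂μ.meas := by
  rw [moment, ofReal_integral_eq_lintegral_ofReal (integrable_weight μ)
    (ae_of_all _ fun x => (one_add_sq_pos x).le), ← measure_univ (μ := μ.meas), ← lintegral_one,
    ← lintegral_add_left measurable_const]
  refine lintegral_congr fun x => ?_
  rw [ENNReal.ofReal_add zero_le_one (by positivity), ENNReal.ofReal_pow (norm_nonneg _),
    ofReal_norm, ENNReal.ofReal_one]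

theorem one_le_moment (μ : P2 d) : 1 ≤ moment μ := by
  have h : (1 : ℝ≥0∞) ≤ ENNReal.ofReal (moment μ) := by
    rw [ofReal_moment]; exact le_self_add
  exact ENNReal.one_le_ofReal.1 h

theorem lintegral_sq_le_ofReal_moment (μ : P2 d) :
    ∫⁻ x, ‖x‖ₑ ^ 2 ∂μ.meas ≤ ENNReal.ofReal (moment μ) := by
  rw [ofReal_moment]; exact le_add_self

theorem moment_le_of_W2_lt {μ ν : P2 d} (h : W2 μ ν < 1) : moment μ ≤ 3 + 2 * moment ν := by
  have h1 := lintegral_sq_le_of_W2_lt h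
  have h0 := zero_le_one.trans (one_le_moment ν)
  refine (ENNReal.ofReal_le_ofReal_iff (by positivity)).1 ?_
  rw [ofReal_moment, ENNReal.ofReal_add (by norm_num) (by positivity),
    ENNReal.ofReal_mul (by norm_num)]
  calc 1 + ∫⁻ x, ‖x‖ₑ ^ 2 ∂μ.meas
      ≤ 1 + (2 * 1 ^ 2 + 2 * ∫⁻ x, ‖x‖ₑ ^ 2 ∂ν.meas) := by gcongr
    _ ≤ 1 + (2 * 1 ^ 2 + 2 * ENNReal.ofReal (moment ν)) := by
        gcongr; exact lintegral_sq_le_ofReal_moment ν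
    _ = _ := by
        rw [← add_assoc]; norm_num

theorem W2_diracZero_le_sqrt_moment (μ : P2 d) :
    W2 (diracZero d) μ ≤ ENNReal.ofReal √(moment μ) := by
  refine W2_diracZero_le μ ((lintegral_sq_le_ofReal_moment μ).trans (le_of_eq ?_))
  rw [← ENNReal.ofReal_pow (Real.sqrt_nonneg _),
    Real.sq_sqrt (zero_le_one.trans (one_le_moment μ))]

theorem tendsto_integral_truncWeight (μ : P2 d) :
    Tendsto (fun n : ℕ => ∫ x, truncWeight (1 / ((n : ℝ) + 1)) x ∂μ.meas) atTop
      (𝓝 (moment μ)) := by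
  refine tendsto_integral_of_dominated_convergence (fun x => 1 + ‖x‖ ^ 2)
    (fun n => (contDiff_truncWeight _).continuous.aestronglyMeasurable) (integrable_weight μ)
    (fun n => ae_of_all _ fun x => ?_) (ae_of_all _ fun x => ?_)
  · rw [truncWeight, Real.norm_of_nonneg (mul_nonneg (one_add_sq_pos x).le (cutoff_nonneg _ _))]
    exact mul_le_of_le_one_right (one_add_sq_pos x).le (cutoff_le_one _ _)
  · simpa [truncWeight] using (tendsto_cutoff x).const_mul (1 + ‖x‖ ^ 2)

theorem integrable_truncWeight {ε : ℝ} (hε : 0 < ε) (μ : P2 d) :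
    Integrable (truncWeight ε) μ.meas :=
  (contDiff_truncWeight ε).continuous.integrable_of_hasCompactSupport
    (hasCompactSupport_truncWeight hε)

theorem integrable_tail (ε : ℝ) (μ : P2 d) :
    Integrable (fun x => (1 + ‖x‖ ^ 2) * (1 - cutoff ε x)) μ.meas := by
  refine (integrable_weight μ).mono' (Continuous.aestronglyMeasurable ?_) (ae_of_all _ fun x => ?_)
  · have := (contDiff_cutoff (d := d) ε).continuous
    fun_prop
  · rw [Real.norm_of_nonneg (mul_nonneg (one_add_sq_pos x).le (sub_nonneg.2 (cutoff_le_one _ _)))]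
    exact mul_le_of_le_one_right (one_add_sq_pos x).le (by linarith [cutoff_nonneg ε x])

theorem tailMoment_eq {ε : ℝ} (hε : 0 < ε) (μ : P2 d) :
    tailMoment ε μ = moment μ - ∫ x, truncWeight ε x ∂μ.meas := by
  rw [moment, ← integral_sub (integrable_weight μ) (integrable_truncWeight hε μ)]
  exact integral_congr_ae (ae_of_all _ fun x => by simp only [truncWeight]; ring)

theorem tailMoment_le_moment (ε : ℝ) (μ : P2 d) : tailMoment ε μ ≤ moment μ :=
  integral_mono (integrable_tail ε μ) (integrable_weight μ) fun x =>
    mul_le_of_le_one_right (one_add_sq_pos x).le (by linarith [cutoff_nonneg ε x])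

theorem tendsto_tailMoment (μ : P2 d) :
    Tendsto (fun n : ℕ => tailMoment (1 / ((n : ℝ) + 1)) μ) atTop (𝓝 0) := by
  have h := (tendsto_integral_truncWeight μ).const_sub (moment μ)
  rw [sub_self] at h
  exact h.congr fun n => (tailMoment_eq (by positivity) μ).symm

theorem setLIntegral_sq_le_tailMoment {ε R : ℝ} (hR : 0 ≤ R) (hε : 0 < ε)
    (h : 2 ≤ ε * Real.log (1 + R ^ 2)) (μ : P2 d) :
    ∫⁻ x in {x | R < ‖x‖}, ‖x‖ₑ ^ 2 ∂μ.meas ≤ ENNReal.ofReal (tailMoment ε μ) := by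
  rw [tailMoment, ofReal_integral_eq_lintegral_ofReal (integrable_tail ε μ) (ae_of_all _ fun x =>
      mul_nonneg (one_add_sq_pos x).le (sub_nonneg.2 (cutoff_le_one _ _))),
    ← lintegral_indicator (measurableSet_lt measurable_const measurable_norm)]
  refine lintegral_mono fun x => ?_
  by_cases hx : R < ‖x‖
  · rw [indicator_of_mem (by exact hx), cutoff_eq_zero, sub_zero, mul_one, ← ofReal_norm,
      ← ENNReal.ofReal_pow (norm_nonneg _)]
    · exact ENNReal.ofReal_le_ofReal (by linarith)
    · refine h.trans (mul_le_mul_of_nonneg_left (Real.log_le_log (by positivity) ?_) hε.le)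
      gcongr
  · rw [indicator_of_notMem (by exact hx)]; exact bot_le

end Cutoff

/-! ### Admissible curves with a given velocity field -/

/-- `v` is a velocity field that makes `c` an admissible trajectory on `[a, b]`. -/
structure IsDrivenBy {d : ℕ} (F : P2 d → E d → Set (E d)) (a b : ℝ) (c : ℝ → P2 d)
    (v : ℝ → E d → E d) : Prop where
  continuous : ∀ t ∈ Icc a b, Tendsto (fun s => W2 (c s) (c t)) (𝓝[Icc a b] t) (𝓝 0)
  measurable : Measurable (Function.uncurry v)
  mem : ∀ᵐ t ∂(volume.restrict (Icc a b)),
    Integrable (v t) (c t).meas ∧ ∀ᵐ x ∂(c t).meas, v t x ∈ F (c t) x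
  integrableOn : ∀ ψ : E d → ℝ, ContDiff ℝ 1 ψ → HasCompactSupport ψ →
    IntegrableOn (fun t => ∫ x, fderiv ℝ ψ x (v t x) ∂(c t).meas) (Icc a b)
  weak : ∀ ψ : E d → ℝ, ContDiff ℝ 1 ψ → HasCompactSupport ψ →
    ∀ s ∈ Icc a b, ∀ t ∈ Icc a b,
      ∫ x, ψ x ∂(c t).meas - ∫ x, ψ x ∂(c s).meas =
        ∫ τ in s..t, ∫ x, fderiv ℝ ψ x (v τ x) ∂(c τ).meas

theorem isAdmissible_iff {d : ℕ} {F : P2 d → E d → Set (E d)} {a b : ℝ} {c : ℝ → P2 d} :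
    IsAdmissible F a b c ↔ ∃ v, IsDrivenBy F a b c v := by
  constructor
  · rintro ⟨hc, v, hv, hmem, hw⟩
    exact ⟨v, hc, hv, hmem, fun ψ h h' => (hw ψ h h').1, fun ψ h h' => (hw ψ h h').2⟩
  · rintro ⟨v, h⟩
    exact ⟨h.continuous, v, h.measurable, h.mem, fun ψ h1 h2 =>
      ⟨h.integrableOn ψ h1 h2, h.weak ψ h1 h2⟩⟩

/-! ### Growth of moments and tails along admissible curves -/

section Estimates

variable {d : ℕ} {F : P2 d → E d → Set (E d)} {L : ℝ}

/-- Every value is compared with the compact set `F (δ₀, 0)` through the Lipschitz condition. The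
resulting additive constant is absorbed because `moment μ ≥ 1`. -/
theorem StandingHyp.exists_growth (hF : StandingHyp F L) :
    ∃ A : ℝ, 0 < A ∧ ∀ μ x, ∀ y ∈ F μ x, ‖y‖ ≤ A * (√(moment μ) + ‖x‖) := by
  obtain ⟨M, hM⟩ := (hF.compact (diracZero d) 0).isBounded.exists_norm_le
  have hM0 : 0 ≤ M := by
    obtain ⟨z, hz⟩ := hF.nonempty (diracZero d) 0
    exact (norm_nonneg z).trans (hM z hz)
  have hL := hF.pos
  refine ⟨M + L, by positivity, fun μ x y hy => ?_⟩
  obtain ⟨z, hz, hyz⟩ := hF.lipschitz (diracZero d) 0 μ x y hy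
  have h1 : edist y z ≤ ENNReal.ofReal (L * (√(moment μ) + ‖x‖)) := by
    rw [ENNReal.ofReal_mul hL.le, ENNReal.ofReal_add (Real.sqrt_nonneg _) (norm_nonneg _)]
    refine hyz.trans ?_
    gcongr
    · exact W2_diracZero_le_sqrt_moment μ
    · rw [edist_dist, dist_zero_left]
  rw [edist_dist, ENNReal.ofReal_le_ofReal_iff (by positivity), dist_eq_norm] at h1
  have h2 := hM z hz
  have h3 : ‖y‖ ≤ ‖z‖ + ‖y - z‖ := norm_le_norm_add_norm_sub' y z
  have h4 : 1 ≤ √(moment μ) := Real.one_le_sqrt.2 (one_le_moment μ)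
  nlinarith [norm_nonneg x, mul_nonneg hM0 (norm_nonneg x)]

theorem IsDrivenBy.mono {a b a' b' : ℝ} {c : ℝ → P2 d} {v : ℝ → E d → E d}
    (h : IsDrivenBy F a b c v) (hs : Icc a' b' ⊆ Icc a b) : IsDrivenBy F a' b' c v where
  continuous t ht := (h.continuous t (hs ht)).mono_left (nhdsWithin_mono _ hs)
  measurable := h.measurable
  mem := ae_mono (Measure.restrict_mono hs le_rfl) h.mem
  integrableOn ψ h1 h2 := (h.integrableOn ψ h1 h2).mono_set hs
  weak ψ h1 h2 s hs' t ht' := h.weak ψ h1 h2 s (hs hs') t (hs ht')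

theorem IsDrivenBy.sub_le {a b : ℝ} {c : ℝ → P2 d} {v : ℝ → E d → E d}
    (h : IsDrivenBy F a b c v) {ψ : E d → ℝ} (hψ : ContDiff ℝ 1 ψ) (hψc : HasCompactSupport ψ)
    {s t : ℝ} (hs : s ∈ Icc a b) (ht : t ∈ Icc a b) (hst : s ≤ t) {B : ℝ}
    (hB : ∀ τ ∈ Icc s t, (∀ᵐ x ∂(c τ).meas, v τ x ∈ F (c τ) x) →
      |∫ x, fderiv ℝ ψ x (v τ x) ∂(c τ).meas| ≤ B) :
    |∫ x, ψ x ∂(c t).meas - ∫ x, ψ x ∂(c s).meas| ≤ B * (t - s) := by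
  rw [h.weak ψ hψ hψc s hs t ht]
  have hae : ∀ᵐ τ, τ ∈ uIoc s t → ‖∫ x, fderiv ℝ ψ x (v τ x) ∂(c τ).meas‖ ≤ B := by
    have := (ae_restrict_iff' measurableSet_Icc).1 h.mem
    filter_upwards [this] with τ hτ hτm
    rw [uIoc_of_le hst] at hτm
    exact hB τ (Ioc_subset_Icc_self hτm)
      (hτ ⟨hs.1.trans hτm.1.le, hτm.2.trans ht.2⟩).2
  have := intervalIntegral.norm_integral_le_of_norm_le_const_ae hae
  rwa [Real.norm_eq_abs, abs_of_nonneg (sub_nonneg.2 hst)] at this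

/-- A qualitative bound from `W2`-continuity and compactness. It makes the supremum in
`le_two_mul_of_absorb` finite. -/
theorem IsDrivenBy.exists_moment_le {a b : ℝ} {c : ℝ → P2 d} {v : ℝ → E d → E d}
    (h : IsDrivenBy F a b c v) : ∃ B, ∀ τ ∈ Icc a b, moment (c τ) ≤ B := by
  refine isCompact_Icc.induction_on (p := fun S => ∃ B, ∀ τ ∈ S, moment (c τ) ≤ B)
    ⟨0, by simp⟩ (fun S S' hSS ⟨B, hB⟩ => ⟨B, fun τ hτ => hB τ (hSS hτ)⟩)
    (fun S S' ⟨B, hB⟩ ⟨B', hB'⟩ => ⟨max B B', fun τ hτ => ?_⟩) fun t ht => ?_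
  · rcases hτ with hτ | hτ
    · exact (hB τ hτ).trans (le_max_left _ _)
    · exact (hB' τ hτ).trans (le_max_right _ _)
  · exact ⟨_, (h.continuous t ht).eventually (gt_mem_nhds one_pos), 3 + 2 * moment (c t),
      fun τ hτ => moment_le_of_W2_lt hτ⟩

/-- If a function that is bounded above on `s` satisfies `f ≤ m + B / 2` whenever `f ≤ B`, then
`f ≤ 2 m`. -/
theorem le_two_mul_of_absorb {α : Type*} {s : Set α} {f : α → ℝ} {m B₀ : ℝ}
    (h0 : ∀ τ ∈ s, f τ ≤ B₀)
    (h : ∀ B, (∀ τ ∈ s, f τ ≤ B) → ∀ τ ∈ s, f τ ≤ m + B / 2) : ∀ τ ∈ s, f τ ≤ 2 * m := by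
  intro τ hτ
  have hbdd : BddAbove (f '' s) := ⟨B₀, by rintro _ ⟨τ, hτ, rfl⟩; exact h0 τ hτ⟩
  have h1 := h (sSup (f '' s)) fun τ hτ => le_csSup hbdd (mem_image_of_mem f hτ)
  have h2 : sSup (f '' s) ≤ m + sSup (f '' s) / 2 := by
    refine csSup_le ⟨_, mem_image_of_mem f hτ⟩ ?_
    rintro _ ⟨τ, hτ, rfl⟩
    exact h1 τ hτ
  have h3 := h1 τ hτ
  linarith

theorem abs_inner_le_of_growth {A N : ℝ} (hA : 0 < A) (hN : 1 ≤ N) {x y : E d}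
    (h : ‖y‖ ≤ A * (√N + ‖x‖)) : |inner ℝ x y| ≤ A * (N + 2 * (1 + ‖x‖ ^ 2)) := by
  refine (abs_real_inner_le_norm x y).trans ?_
  have h1 : √N * ‖x‖ ≤ N + (1 + ‖x‖ ^ 2) := by
    nlinarith [Real.sq_sqrt (zero_le_one.trans hN), sq_nonneg (√N - ‖x‖), norm_nonneg x,
      Real.sqrt_nonneg N]
  calc ‖x‖ * ‖y‖ ≤ ‖x‖ * (A * (√N + ‖x‖)) := by gcongr
    _ = A * (√N * ‖x‖ + ‖x‖ ^ 2) := by ring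
    _ ≤ A * (N + 2 * (1 + ‖x‖ ^ 2)) := mul_le_mul_of_nonneg_left (by linarith) hA.le

/-- The truncated weights are admissible test functions. By linear growth their rates are bounded by
a multiple of the moment, uniformly in the truncation, so the cutoff can be removed. The factor `6`
is `2` from differentiating `|x|²` times `N + 2 N = 3 N`. -/
theorem StandingHyp.exists_moment_rate (hF : StandingHyp F L) : ∃ C : ℝ, 0 < C ∧
    ∀ {a b : ℝ} {c : ℝ → P2 d} {v : ℝ → E d → E d}, IsDrivenBy F a b c v →
      ∀ s ∈ Icc a b, ∀ t ∈ Icc a b, s ≤ t → ∀ B, (∀ τ ∈ Icc s t, moment (c τ) ≤ B) →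
        moment (c t) ≤ moment (c s) + C * B * (t - s) := by
  obtain ⟨A, hA, hgrow⟩ := hF.exists_growth
  obtain ⟨Cθ, hCθ, hθ⟩ := exists_deriv_smoothTransition_le
  refine ⟨6 * (1 + Cθ) * A, by positivity, fun {a b c v} h s hs t ht hst B hB => ?_⟩
  have hn : ∀ n : ℕ, ∫ x, truncWeight (1 / ((n : ℝ) + 1)) x ∂(c t).meas ≤
      ∫ x, truncWeight (1 / ((n : ℝ) + 1)) x ∂(c s).meas + 6 * (1 + Cθ) * A * B * (t - s) := by
    intro n
    have hε : 0 < 1 / ((n : ℝ) + 1) := by positivity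
    have hε1 : 1 / ((n : ℝ) + 1) ≤ 1 := by
      rw [div_le_one (by positivity)]; linarith [Nat.cast_nonneg (α := ℝ) n]
    have := h.sub_le (contDiff_truncWeight (1 / ((n : ℝ) + 1))) (hasCompactSupport_truncWeight hε)
      hs ht hst (B := 6 * (1 + Cθ) * A * B) fun τ hτ hv => ?_
    · linarith [le_abs_self (∫ x, truncWeight (1 / ((n : ℝ) + 1)) x ∂(c t).meas -
        ∫ x, truncWeight (1 / ((n : ℝ) + 1)) x ∂(c s).meas)]
    set N := moment (c τ) with hN
    have hN1 := one_le_moment (c τ)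
    have hbound : |∫ x, fderiv ℝ (truncWeight (1 / ((n : ℝ) + 1))) x (v τ x) ∂(c τ).meas| ≤
        ∫ x, 2 * (1 + Cθ) * A * (N + 2 * (1 + ‖x‖ ^ 2)) ∂(c τ).meas := by
      rw [← Real.norm_eq_abs]
      refine norm_integral_le_of_norm_le
        (((integrable_const N).add ((integrable_weight (c τ)).const_mul 2)).const_mul _) ?_
      filter_upwards [hv] with x hx
      have h1 := abs_inner_le_of_growth hA hN1 (hgrow _ _ _ hx)
      rw [fderiv_truncWeight, Real.norm_eq_abs, abs_mul, abs_mul, abs_two]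
      have h2 : |cutoff (1 / ((n : ℝ) + 1)) x - 1 / ((n : ℝ) + 1) * deriv Real.smoothTransition
          (2 - 1 / ((n : ℝ) + 1) * Real.log (1 + ‖x‖ ^ 2))| ≤ 1 + Cθ := by
        refine (abs_sub _ _).trans (add_le_add ?_ ?_)
        · rw [abs_of_nonneg (cutoff_nonneg _ _)]; exact cutoff_le_one _ _
        · rw [abs_mul, abs_of_pos hε]
          exact (mul_le_mul hε1 (hθ _) (abs_nonneg _) zero_le_one).trans (one_mul _).le
      calc _ ≤ (1 + Cθ) * (2 * (A * (N + 2 * (1 + ‖x‖ ^ 2)))) := by gcongr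
        _ = _ := by ring
    refine hbound.trans ?_
    rw [integral_const_mul, integral_add (integrable_const _) ((integrable_weight _).const_mul 2),
      integral_const_mul, integral_const, probReal_univ, one_smul]
    change 2 * (1 + Cθ) * A * (N + 2 * N) ≤ _
    have := hB τ hτ
    calc 2 * (1 + Cθ) * A * (N + 2 * N) = 6 * (1 + Cθ) * A * N := by ring
      _ ≤ _ := by gcongr
  exact le_of_tendsto_of_tendsto' (tendsto_integral_truncWeight _)
    ((tendsto_integral_truncWeight _).add_const _) hn

theorem StandingHyp.exists_moment_le (hF : StandingHyp F L) {T : ℝ} (hT : 0 < T)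
    {c : ℝ → P2 d} {v : ℝ → E d → E d} (h : ∀ T' < T, IsDrivenBy F 0 T' c v) :
    ∃ s ∈ Ico 0 T, ∃ B, ∀ t ∈ Ico s T, moment (c t) ≤ B := by
  obtain ⟨C, hC, hrate⟩ := hF.exists_moment_rate
  have hC2 : 0 < 1 / (2 * C) := by positivity
  -- On a final stretch of length at most `1 / (2 C)` the increase is at most half of any upper
  -- bound, so it can be absorbed, and the result does not depend on how close `t` is to `T`.
  refine ⟨max 0 (T - 1 / (2 * C)), ⟨le_max_left _ _, max_lt hT (by linarith)⟩, ?_⟩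
  set s := max 0 (T - 1 / (2 * C))
  have hsT : T - s ≤ 1 / (2 * C) := by linarith [le_max_right 0 (T - 1 / (2 * C))]
  have hs0 : 0 ≤ s := le_max_left _ _
  refine ⟨2 * moment (c s), fun t ht => ?_⟩
  have hd := h t ht.2
  obtain ⟨B₀, hB₀⟩ := (hd.mono (Icc_subset_Icc_left hs0)).exists_moment_le
  refine le_two_mul_of_absorb hB₀ (fun B hB τ hτ => ?_) t ⟨ht.1, le_rfl⟩
  have h1 := hrate hd s ⟨hs0, ht.1⟩ τ ⟨hs0.trans hτ.1, hτ.2⟩ hτ.1 B fun q hq =>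
    hB q ⟨hq.1, hq.2.trans hτ.2⟩
  have hB0 : 0 ≤ B := (zero_le_one.trans (one_le_moment _)).trans (hB τ hτ)
  have h2 : C * B * (τ - s) ≤ B / 2 := by
    have : τ - s ≤ 1 / (2 * C) := by linarith [hτ.2, ht.2]
    calc C * B * (τ - s) ≤ C * B * (1 / (2 * C)) := by gcongr
      _ = B / 2 := by field_simp
  linarith

/-- The tail is the limit of differences of two truncated weights, which are compactly supported.
The derivative of such a difference sees the removed part `1 - cutoff ε` and two cutoff errors of
order `ε`. Hence the growth of the tail is proportional to the tail itself plus `ε`. -/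
theorem StandingHyp.exists_tail_rate (hF : StandingHyp F L) {N : ℝ} (hN : 1 ≤ N) :
    ∃ C : ℝ, 0 < C ∧
    ∀ {a b : ℝ} {c : ℝ → P2 d} {v : ℝ → E d → E d}, IsDrivenBy F a b c v →
      ∀ s ∈ Icc a b, ∀ t ∈ Icc a b, s ≤ t → (∀ τ ∈ Icc s t, moment (c τ) ≤ N) →
      ∀ ε, 0 < ε → ∀ B, (∀ τ ∈ Icc s t, tailMoment ε (c τ) ≤ B) →
        tailMoment ε (c t) ≤ tailMoment ε (c s) + C * (B + ε) * (t - s) := by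
  obtain ⟨A, hA, hgrow⟩ := hF.exists_growth
  obtain ⟨Cθ, hCθ, hθ⟩ := exists_deriv_smoothTransition_le
  set A' := A * (N + 2) with hA'
  have hA'0 : 0 < A' := by positivity
  refine ⟨2 * A' * (1 + 2 * Cθ * N), by positivity,
    fun {a b c v} h s hs t ht hst hNτ ε hε B hB => ?_⟩
  have hB0 : 0 ≤ B := by
    refine le_trans ?_ (hB s ⟨le_rfl, hst⟩)
    exact integral_nonneg fun x =>
      mul_nonneg (one_add_sq_pos x).le (sub_nonneg.2 (cutoff_le_one _ _))
  have hev : ∀ᶠ n : ℕ in atTop, (∫ x, truncWeight (1 / ((n : ℝ) + 1)) x ∂(c t).meas -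
      ∫ x, truncWeight ε x ∂(c t).meas) ≤ (∫ x, truncWeight (1 / ((n : ℝ) + 1)) x ∂(c s).meas -
      ∫ x, truncWeight ε x ∂(c s).meas) + 2 * A' * (1 + 2 * Cθ * N) * (B + ε) * (t - s) := by
    filter_upwards [(tendsto_one_div_add_atTop_nhds_zero_nat (𝕜 := ℝ)).eventually
      (gt_mem_nhds hε)] with n hn
    set δ := 1 / ((n : ℝ) + 1) with hδ
    have hδ0 : 0 < δ := by positivity
    have hψd : ContDiff ℝ 1 (truncWeight δ - truncWeight ε : E d → ℝ) :=
      (contDiff_truncWeight δ).sub (contDiff_truncWeight ε)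
    have hψc : HasCompactSupport (truncWeight δ - truncWeight ε : E d → ℝ) :=
      (hasCompactSupport_truncWeight hδ0).sub (hasCompactSupport_truncWeight hε)
    have := h.sub_le hψd hψc hs ht hst (B := 2 * A' * (1 + 2 * Cθ * N) * (B + ε))
      fun τ hτ hv => ?_
    · simp only [Pi.sub_apply] at this
      rw [integral_sub (integrable_truncWeight hδ0 _) (integrable_truncWeight hε _),
        integral_sub (integrable_truncWeight hδ0 _) (integrable_truncWeight hε _)] at this
      linarith [(le_abs_self _).trans this]
    have hNτ' := hNτ τ hτ
    have hN1 := one_le_moment (c τ)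
    have hbound : |∫ x, fderiv ℝ (truncWeight δ - truncWeight ε) x (v τ x) ∂(c τ).meas| ≤
        ∫ x, (2 * A' * ((1 + ‖x‖ ^ 2) * (1 - cutoff ε x)) + 4 * A' * Cθ * ε * (1 + ‖x‖ ^ 2))
          ∂(c τ).meas := by
      rw [← Real.norm_eq_abs]
      refine norm_integral_le_of_norm_le
        (((integrable_tail ε _).const_mul _).add ((integrable_weight _).const_mul _)) ?_
      filter_upwards [hv] with x hx
      have hw := one_add_sq_pos x
      have h1 : |inner ℝ x (v τ x)| ≤ A' * (1 + ‖x‖ ^ 2) := by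
        refine (abs_inner_le_of_growth hA hN1 (hgrow _ _ _ hx)).trans ?_
        rw [hA', mul_assoc]
        gcongr
        nlinarith [sq_nonneg ‖x‖]
      rw [fderiv_sub ((contDiff_truncWeight δ).differentiable (by simp) x)
        ((contDiff_truncWeight ε).differentiable (by simp) x), sub_apply, fderiv_truncWeight,
        fderiv_truncWeight, ← sub_mul, Real.norm_eq_abs, abs_mul, abs_mul, abs_two]
      set p := deriv Real.smoothTransition (2 - δ * Real.log (1 + ‖x‖ ^ 2))
      set q := deriv Real.smoothTransition (2 - ε * Real.log (1 + ‖x‖ ^ 2))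
      have hp : |δ * p| ≤ ε * Cθ := by
        rw [abs_mul, abs_of_pos hδ0]
        exact mul_le_mul hn.le (hθ _) (abs_nonneg _) hε.le
      have hq : |ε * q| ≤ ε * Cθ := by
        rw [abs_mul, abs_of_pos hε]
        exact mul_le_mul le_rfl (hθ _) (abs_nonneg _) hε.le
      have h2 : |cutoff δ x - δ * p - (cutoff ε x - ε * q)| ≤ (1 - cutoff ε x) + 2 * ε * Cθ := by
        have a1 := cutoff_anti hn.le x
        have a2 := cutoff_le_one δ x
        rw [abs_le] at hp hq ⊢
        constructor <;> linarith [hp.1, hp.2, hq.1, hq.2]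
      calc _ ≤ ((1 - cutoff ε x) + 2 * ε * Cθ) * (2 * (A' * (1 + ‖x‖ ^ 2))) := by
            refine mul_le_mul h2 (by gcongr) (by positivity) ?_
            have := cutoff_le_one ε x
            have := mul_nonneg hε.le hCθ
            linarith
        _ = _ := by ring
    refine hbound.trans ?_
    rw [integral_add ((integrable_tail ε _).const_mul _) ((integrable_weight _).const_mul _),
      integral_const_mul, integral_const_mul]
    change 2 * A' * tailMoment ε (c τ) + 4 * A' * Cθ * ε * moment (c τ) ≤ _
    have := hB τ hτ
    calc 2 * A' * tailMoment ε (c τ) + 4 * A' * Cθ * ε * moment (c τ)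
        ≤ 2 * A' * B + 4 * A' * Cθ * ε * N := by gcongr
      -- Nonnegative cross terms are added only to factor the bound as a constant times `B + ε`.
      _ ≤ 2 * A' * B + 4 * A' * Cθ * ε * N + (2 * A' * (2 * Cθ * N) * B + 2 * A' * ε) := by
          have : 0 ≤ 2 * A' * (2 * Cθ * N) * B + 2 * A' * ε := by positivity
          linarith
      _ = _ := by ring
  have hlim := le_of_tendsto_of_tendsto ((tendsto_integral_truncWeight (c t)).sub_const _)
    (((tendsto_integral_truncWeight (c s)).sub_const _).add_const _) hev
  rwa [tailMoment_eq hε, tailMoment_eq hε]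

/-- Absorption on a short final interval bounds the tail there by `2 (tailMoment ε (c s) + ε / 2)`,
which is small for small `ε`. The starting time `s` depends on the constants only, not on `e`. -/
theorem StandingHyp.exists_tailMoment_le (hF : StandingHyp F L) {T : ℝ} (hT : 0 < T)
    {c : ℝ → P2 d} {v : ℝ → E d → E d} (h : ∀ T' < T, IsDrivenBy F 0 T' c v) :
    ∃ s ∈ Ico 0 T, ∀ e : ℝ, 0 < e → ∃ ε, 0 < ε ∧ ∀ t ∈ Ico s T, tailMoment ε (c t) ≤ e := by
  obtain ⟨s₀, hs₀, N, hN⟩ := hF.exists_moment_le hT h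
  have hN1 : 1 ≤ N := (one_le_moment _).trans (hN s₀ ⟨le_rfl, hs₀.2⟩)
  obtain ⟨C, hC, hrate⟩ := hF.exists_tail_rate hN1
  have hC2 : 0 < 1 / (2 * C) := by positivity
  refine ⟨max s₀ (T - 1 / (2 * C)), ⟨hs₀.1.trans (le_max_left _ _),
    max_lt hs₀.2 (by linarith)⟩, ?_⟩
  set s := max s₀ (T - 1 / (2 * C))
  have hsT : T - s ≤ 1 / (2 * C) := by linarith [le_max_right s₀ (T - 1 / (2 * C))]
  have hss₀ : s₀ ≤ s := le_max_left _ _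
  have hs0 : 0 ≤ s := hs₀.1.trans hss₀
  intro e he
  have hlim : Tendsto (fun n : ℕ => 2 * (tailMoment (1 / ((n : ℝ) + 1)) (c s) +
      1 / ((n : ℝ) + 1) / 2)) atTop (𝓝 0) := by
    have := ((tendsto_tailMoment (c s)).add
      ((tendsto_one_div_add_atTop_nhds_zero_nat (𝕜 := ℝ)).div_const 2)).const_mul 2
    simpa using this
  obtain ⟨n, hn⟩ := (hlim.eventually (gt_mem_nhds he)).exists
  have hε : 0 < 1 / ((n : ℝ) + 1) := by positivity
  refine ⟨1 / ((n : ℝ) + 1), hε, fun t ht => le_trans ?_ hn.le⟩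
  have hd := h t ht.2
  refine le_two_mul_of_absorb (s := Icc s t) (f := fun τ => tailMoment (1 / ((n : ℝ) + 1)) (c τ))
    (B₀ := N) (fun τ hτ => ?_) (fun B hB τ hτ => ?_) t ⟨ht.1, le_rfl⟩
  · exact (tailMoment_le_moment _ _).trans (hN τ ⟨hss₀.trans hτ.1, hτ.2.trans_lt ht.2⟩)
  have h1 := hrate hd s ⟨hs0, ht.1⟩ τ ⟨hs0.trans hτ.1, hτ.2⟩ hτ.1
    (fun q hq => hN q ⟨hss₀.trans hq.1, (hq.2.trans hτ.2).trans_lt ht.2⟩) _ hε B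
    fun q hq => hB q ⟨hq.1, hq.2.trans hτ.2⟩
  have hB0 : 0 ≤ B := by
    refine le_trans ?_ (hB s ⟨le_rfl, ht.1⟩)
    exact integral_nonneg fun x =>
      mul_nonneg (one_add_sq_pos x).le (sub_nonneg.2 (cutoff_le_one _ _))
  have h2 : C * (B + 1 / ((n : ℝ) + 1)) * (τ - s) ≤ (B + 1 / ((n : ℝ) + 1)) / 2 := by
    have : τ - s ≤ 1 / (2 * C) := by linarith [hτ.2, ht.2]
    calc C * (B + 1 / ((n : ℝ) + 1)) * (τ - s)
        ≤ C * (B + 1 / ((n : ℝ) + 1)) * (1 / (2 * C)) := by gcongr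
      _ = (B + 1 / ((n : ℝ) + 1)) / 2 := by field_simp
  linarith

end Estimates

/-! ### Extension of an admissible curve to the end of its interval -/

section Limit

variable {d : ℕ} {F : P2 d → E d → Set (E d)} {L : ℝ}

theorem StandingHyp.exists_uniform_tail_le (hF : StandingHyp F L) {T : ℝ} (hT : 0 < T)
    {c : ℝ → P2 d} {v : ℝ → E d → E d} (h : ∀ T' < T, IsDrivenBy F 0 T' c v) :
    ∃ s ∈ Ico 0 T, ∀ e : ℝ≥0∞, 0 < e → ∃ R₀, 1 ≤ R₀ ∧ ∀ R, R₀ ≤ R → ∀ t ∈ Ico s T,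
      ∫⁻ x in {x | R < ‖x‖}, ‖x‖ₑ ^ 2 ∂(c t).meas ≤ e := by
  obtain ⟨s, hs, htail⟩ := hF.exists_tailMoment_le hT h
  refine ⟨s, hs, fun e he => ?_⟩
  obtain ⟨e', he', hee⟩ : ∃ e' : ℝ, 0 < e' ∧ ENNReal.ofReal e' ≤ e := by
    rcases eq_or_ne e ∞ with rfl | hne
    · exact ⟨1, one_pos, le_top⟩
    · exact ⟨e.toReal, ENNReal.toReal_pos he.ne' hne, ENNReal.ofReal_toReal_le⟩
  obtain ⟨ε, hε, hle⟩ := htail e' he'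
  have h1 : 1 ≤ Real.exp (1 / ε) := Real.one_le_exp (by positivity)
  refine ⟨Real.exp (1 / ε), h1, fun R hR t ht => ?_⟩
  have hR0 : 0 < R := by linarith
  refine (setLIntegral_sq_le_tailMoment hR0.le hε ?_ _).trans
    ((ENNReal.ofReal_le_ofReal (hle t ht)).trans hee)
  have h2 : Real.log (R ^ 2) ≤ Real.log (1 + R ^ 2) := Real.log_le_log (by positivity) (by linarith)
  have h3 : 1 / ε ≤ Real.log R := (Real.le_log_iff_exp_le hR0).2 hR
  rw [Real.log_pow] at h2
  push_cast at h2
  calc (2 : ℝ) = ε * (2 * (1 / ε)) := by field_simp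
    _ ≤ ε * Real.log (1 + R ^ 2) := by gcongr; linarith

theorem Ico_eq_iUnion_Icc (a b : ℝ) :
    Ico a b = ⋃ n : ℕ, Icc a (b - 1 / ((n : ℝ) + 1)) := by
  ext t
  simp only [mem_Ico, mem_iUnion, mem_Icc]
  constructor
  · rintro ⟨h1, h2⟩
    obtain ⟨n, hn⟩ := exists_nat_one_div_lt (sub_pos.2 h2)
    exact ⟨n, h1, by linarith⟩
  · rintro ⟨n, h1, h2⟩
    have : 0 < 1 / ((n : ℝ) + 1) := by positivity
    exact ⟨h1, by linarith⟩

theorem ae_mem_of_forall_lt {T : ℝ} {c : ℝ → P2 d} {v : ℝ → E d → E d}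
    (h : ∀ T' < T, IsDrivenBy F 0 T' c v) :
    ∀ᵐ t ∂(volume.restrict (Ico 0 T)),
      Integrable (v t) (c t).meas ∧ ∀ᵐ x ∂(c t).meas, v t x ∈ F (c t) x := by
  rw [Ico_eq_iUnion_Icc, ae_restrict_iUnion_iff]
  exact fun n => (h _ (sub_lt_self _ (by positivity))).mem

theorem StandingHyp.integrableOn_rate (hF : StandingHyp F L) {T : ℝ} (hT : 0 < T)
    {c : ℝ → P2 d} {v : ℝ → E d → E d} (h : ∀ T' < T, IsDrivenBy F 0 T' c v)
    {ψ : E d → ℝ} (hψ : ContDiff ℝ 1 ψ) (hψc : HasCompactSupport ψ) :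
    IntegrableOn (fun t => ∫ x, fderiv ℝ ψ x (v t x) ∂(c t).meas) (Ico 0 T) := by
  obtain ⟨s, hs, B, hB⟩ := hF.exists_moment_le hT h
  obtain ⟨A, hA, hgrow⟩ := hF.exists_growth
  have hmeas : AEStronglyMeasurable (fun t => ∫ x, fderiv ℝ ψ x (v t x) ∂(c t).meas)
      (volume.restrict (Ico 0 T)) := by
    rw [Ico_eq_iUnion_Icc, aestronglyMeasurable_iUnion_iff]
    exact fun n => ((h _ (sub_lt_self _ (by positivity))).integrableOn ψ hψ hψc).1
  obtain ⟨M, hM⟩ : ∃ M, ∀ x, ‖‖fderiv ℝ ψ x‖ * (A * (√B + ‖x‖))‖ ≤ M := by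
    have hc : Continuous fun x => ‖fderiv ℝ ψ x‖ * (A * (√B + ‖x‖)) := by
      have := hψ.continuous_fderiv (by simp)
      fun_prop
    have hs : HasCompactSupport fun x => ‖fderiv ℝ ψ x‖ * (A * (√B + ‖x‖)) :=
      ((hψc.fderiv ℝ).norm).mul_right
    exact hc.bounded_above_of_compact_support hs
  rw [← Ico_union_Ico_eq_Ico hs.1 hs.2.le] at hmeas ⊢
  refine IntegrableOn.union (((h s hs.2).integrableOn ψ hψ hψc).mono_set Ico_subset_Icc_self) ?_
  refine ⟨hmeas.mono_measure (Measure.restrict_mono subset_union_right le_rfl),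
    HasFiniteIntegral.of_bounded (C := M) ?_⟩
  have hae := ae_mono (Measure.restrict_mono (Ico_subset_Ico_left hs.1) le_rfl)
    (ae_mem_of_forall_lt h)
  filter_upwards [hae, ae_restrict_mem measurableSet_Ico] with t ht hts
  refine (norm_integral_le_of_norm_le_const (C := M) ?_).trans ?_
  · filter_upwards [ht.2] with x hx
    refine le_trans ?_ ((le_abs_self _).trans (hM x))
    refine (ContinuousLinearMap.le_opNorm _ _).trans ?_
    refine mul_le_mul_of_nonneg_left ((hgrow _ _ _ hx).trans ?_) (norm_nonneg _)
    have := Real.sqrt_le_sqrt (hB t hts)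
    gcongr
  · simp

/-- Integrals of test functions converge because they are primitives of an integrable rate.
Tightness of the curve near `T` supplies a probability measure having these limits as its integrals,
and Fatou's lemma gives it a finite second moment. -/
theorem StandingHyp.exists_weak_limit (hF : StandingHyp F L) {T : ℝ} (hT : 0 < T)
    {c : ℝ → P2 d} {v : ℝ → E d → E d} (h : ∀ T' < T, IsDrivenBy F 0 T' c v) :
    ∃ ν : P2 d, ∀ ψ : E d → ℝ, ContDiff ℝ 1 ψ → HasCompactSupport ψ →
      Tendsto (fun t => ∫ x, ψ x ∂(c t).meas) (𝓝[<] T) (𝓝 (∫ x, ψ x ∂ν.meas)) ∧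
      ∫ x, ψ x ∂ν.meas = ∫ x, ψ x ∂(c 0).meas +
        ∫ τ in 0..T, ∫ x, fderiv ℝ ψ x (v τ x) ∂(c τ).meas := by
  obtain ⟨s, hs, htail⟩ := hF.exists_uniform_tail_le hT h
  obtain ⟨s', hs', B, hB⟩ := hF.exists_moment_le hT h
  have hlim : ∀ ψ : E d → ℝ, ContDiff ℝ 1 ψ → HasCompactSupport ψ →
      Tendsto (fun t => ∫ x, ψ x ∂(c t).meas) (𝓝[<] T) (𝓝 (∫ x, ψ x ∂(c 0).meas +
        ∫ τ in 0..T, ∫ x, fderiv ℝ ψ x (v τ x) ∂(c τ).meas)) := by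
    intro ψ hψ hψc
    have hi : IntegrableOn (fun t => ∫ x, fderiv ℝ ψ x (v t x) ∂(c t).meas) (uIcc 0 T) := by
      rw [uIcc_of_le hT.le, integrableOn_Icc_iff_integrableOn_Ico]
      exact hF.integrableOn_rate hT h hψ hψc
    have h1 := (intervalIntegral.continuousOn_primitive_interval hi) T right_mem_uIcc
    rw [uIcc_of_le hT.le] at h1
    have h2 : Tendsto (fun t => ∫ τ in 0..t, ∫ x, fderiv ℝ ψ x (v τ x) ∂(c τ).meas) (𝓝[<] T)
        (𝓝 (∫ τ in 0..T, ∫ x, fderiv ℝ ψ x (v τ x) ∂(c τ).meas)) := by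
      rw [← nhdsWithin_Ico_eq_nhdsLT hT]
      exact h1.mono_left (nhdsWithin_mono _ Ico_subset_Icc_self)
    refine (h2.const_add (∫ x, ψ x ∂(c 0).meas)).congr' ?_
    filter_upwards [Ico_mem_nhdsLT hT] with t ht
    rw [← (h t ht.2).weak ψ hψ hψc 0 ⟨le_rfl, ht.1⟩ t ⟨ht.1, le_rfl⟩]
    ring
  have htight : IsTightMeasureSet {((μ : ProbabilityMeasure (E d)) : Measure (E d)) |
      μ ∈ (fun t => (c t).1) '' Ico s T} := by
    rw [isTightMeasureSet_iff_exists_isCompact_measure_compl_le]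
    intro e he
    obtain ⟨R, hR1, hR⟩ := htail e he
    refine ⟨Metric.closedBall 0 R, isCompact_closedBall _ _, ?_⟩
    rintro _ ⟨_, ⟨t, ht, rfl⟩, rfl⟩
    refine le_trans ?_ (hR R le_rfl t ht)
    have hset : (Metric.closedBall (0 : E d) R)ᶜ = {x | R < ‖x‖} := by
      ext x; simp
    rw [hset, ← setLIntegral_one]
    -- Since `R ≥ 1`, the mass outside the ball is at most the second moment there.
    refine setLIntegral_mono (by fun_prop) fun x hx => ?_
    have hx : R < ‖x‖ := hx
    refine one_le_pow₀ ?_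
    rw [← ofReal_norm, ENNReal.one_le_ofReal]
    linarith
  have hcomp := isCompact_closure_of_isTightMeasureSet htight
  -- A limit along an ultrafilter finer than the left neighbourhoods of `T` is enough: the test
  -- integrals already converge along the whole filter.
  set U : Ultrafilter ℝ := Ultrafilter.of (𝓝[<] T) with hU
  have hUle : (U : Filter ℝ) ≤ 𝓝[<] T := Ultrafilter.of_le _
  obtain ⟨ν, -, hν⟩ := hcomp.ultrafilter_le_nhds (U.map fun t => (c t).1) (by
    rw [le_principal_iff, Ultrafilter.coe_map, mem_map]
    refine mem_of_superset (hUle (Ico_mem_nhdsLT hs.2)) fun t ht => ?_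
    exact subset_closure (mem_image_of_mem _ ht))
  have hνlim : Tendsto (fun t => (c t).1) U (𝓝 ν) := hν
  rw [ProbabilityMeasure.tendsto_iff_forall_integral_tendsto] at hνlim
  have hψlim : ∀ ψ : E d → ℝ, ContDiff ℝ 1 ψ → HasCompactSupport ψ →
      Tendsto (fun t => ∫ x, ψ x ∂(c t).meas) U (𝓝 (∫ x, ψ x ∂(ν : Measure (E d)))) := by
    intro ψ hψ hψc
    obtain ⟨M, hM⟩ := hψ.continuous.bounded_above_of_compact_support hψc
    exact hνlim (BoundedContinuousFunction.ofNormedAddCommGroup ψ hψ.continuous M hM)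
  have hle : ∀ n : ℕ, ∫ x, truncWeight (1 / ((n : ℝ) + 1)) x ∂(ν : Measure (E d)) ≤ B := by
    intro n
    have hε : 0 < 1 / ((n : ℝ) + 1) := by positivity
    refine le_of_tendsto (hψlim _ (contDiff_truncWeight _) (hasCompactSupport_truncWeight hε)) ?_
    filter_upwards [hUle (Ico_mem_nhdsLT hs'.2)] with t ht
    refine (integral_mono (integrable_truncWeight hε _) (integrable_weight _) fun x => ?_).trans
      (hB t ht)
    exact mul_le_of_le_one_right (one_add_sq_pos x).le (cutoff_le_one _ _)
  have hfin : ∫⁻ x, ‖x‖ₑ ^ 2 ∂(ν : Measure (E d)) < ∞ := by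
    have h0 : ∀ (n : ℕ) (x : E d), 0 ≤ truncWeight (1 / ((n : ℝ) + 1)) x := fun n x =>
      mul_nonneg (one_add_sq_pos x).le (cutoff_nonneg _ _)
    calc ∫⁻ x, ‖x‖ₑ ^ 2 ∂(ν : Measure (E d))
        ≤ ∫⁻ x, liminf (fun n : ℕ => ENNReal.ofReal (truncWeight (1 / ((n : ℝ) + 1)) x)) atTop
            ∂(ν : Measure (E d)) := by
          refine lintegral_mono fun x => ?_
          have ht : Tendsto (fun n : ℕ => ENNReal.ofReal (truncWeight (1 / ((n : ℝ) + 1)) x)) atTop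
              (𝓝 (ENNReal.ofReal (1 + ‖x‖ ^ 2))) :=
            ENNReal.tendsto_ofReal (by
              simpa [truncWeight] using (tendsto_cutoff x).const_mul (1 + ‖x‖ ^ 2))
          simp only [ht.liminf_eq]
          rw [← ofReal_norm, ← ENNReal.ofReal_pow (norm_nonneg _)]
          exact ENNReal.ofReal_le_ofReal (by linarith)
      _ ≤ liminf (fun n : ℕ => ∫⁻ x, ENNReal.ofReal (truncWeight (1 / ((n : ℝ) + 1)) x)
            ∂(ν : Measure (E d))) atTop :=
          lintegral_liminf_le fun n => (contDiff_truncWeight _).continuous.measurable.ennreal_ofReal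
      _ ≤ liminf (fun _ : ℕ => ENNReal.ofReal B) atTop := by
          refine liminf_le_liminf (Eventually.of_forall fun n => ?_)
          rw [← ofReal_integral_eq_lintegral_ofReal
            ((contDiff_truncWeight _).continuous.integrable_of_hasCompactSupport
              (hasCompactSupport_truncWeight (by positivity))) (ae_of_all _ (h0 n))]
          exact ENNReal.ofReal_le_ofReal (hle n)
      _ = ENNReal.ofReal B := liminf_const _
      _ < ∞ := ENNReal.ofReal_lt_top
  refine ⟨⟨ν, hfin⟩, fun ψ hψ hψc => ?_⟩
  have heq := tendsto_nhds_unique (hψlim ψ hψ hψc) ((hlim ψ hψ hψc).mono_left hUle)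
  refine ⟨?_, heq⟩
  change Tendsto _ _ (𝓝 (∫ x, ψ x ∂(ν : Measure (E d))))
  rw [heq]
  exact hlim ψ hψ hψc

/-- An admissible curve on `[0, T)` extends to `[0, T]`. -/
theorem StandingHyp.exists_extension (hF : StandingHyp F L) {T : ℝ} (hT : 0 < T)
    {c : ℝ → P2 d} {v : ℝ → E d → E d} (h : ∀ T' < T, IsDrivenBy F 0 T' c v) :
    ∃ ν : P2 d, Tendsto (fun t => W2 (c t) ν) (𝓝[<] T) (𝓝 0) ∧
      IsDrivenBy F 0 T (Function.update c T ν) v := by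
  obtain ⟨ν, hν⟩ := hF.exists_weak_limit hT h
  obtain ⟨s, hs, htail⟩ := hF.exists_uniform_tail_le hT h
  have hW : Tendsto (fun t => W2 (c t) ν) (𝓝[<] T) (𝓝 0) := by
    refine tendsto_W2_of_tail (fun ψ h1 h2 => (hν ψ h1 h2).1) fun e he => ?_
    obtain ⟨R₀, -, hR⟩ := htail e he
    refine ⟨R₀, fun R hRR => ?_⟩
    filter_upwards [Ico_mem_nhdsLT hs.2] with t ht using hR R hRR t ht
  have hupd : ∀ t, t ≠ T → Function.update c T ν t = c t := fun t ht =>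
    Function.update_of_ne ht _ _
  have hne : ∀ᵐ t : ℝ, t ≠ T := by simp [ae_iff]
  have hrate : ∀ ψ : E d → ℝ, ∀ᵐ t : ℝ,
      ∫ x, fderiv ℝ ψ x (v t x) ∂(c t).meas =
        ∫ x, fderiv ℝ ψ x (v t x) ∂(Function.update c T ν t).meas := fun ψ => by
    filter_upwards [hne] with t ht
    rw [hupd t ht]
  refine ⟨ν, hW, ⟨fun t ht => ?_, (h 0 hT).measurable, ?_, fun ψ hψ hψc => ?_,
    fun ψ hψ hψc => ?_⟩⟩
  · rcases eq_or_lt_of_le ht.2 with rfl | htT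
    · rw [← Ico_insert_right hT.le, nhdsWithin_insert, tendsto_sup, Function.update_self]
      refine ⟨?_, ?_⟩
      · rw [tendsto_pure_left]
        intro s hs
        rw [Function.update_self, W2_self]
        exact mem_of_mem_nhds hs
      · rw [nhdsWithin_Ico_eq_nhdsLT hT]
        refine hW.congr' ?_
        filter_upwards [self_mem_nhdsWithin] with q hq
        rw [hupd q (ne_of_lt hq)]
    · rw [hupd t htT.ne]
      set T' := (t + T) / 2 with hT'
      have h1 : t < T' := by rw [hT']; linarith
      have h2 : T' < T := by rw [hT']; linarith
      -- Before `T` continuity is local, so the endpoint can be cut off and the hypothesis on `[0,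
      -- T']` applies.
      have heq : 𝓝[Icc 0 T] t = 𝓝[Icc 0 T'] t := by
        refine nhdsWithin_eq_nhdsWithin (s := Iio T') h1 isOpen_Iio ?_
        ext q
        simp only [mem_inter_iff, mem_Icc, mem_Iio]
        constructor
        · rintro ⟨⟨a, -⟩, b⟩; exact ⟨⟨a, b.le⟩, b⟩
        · rintro ⟨⟨a, -⟩, b⟩; exact ⟨⟨a, b.le.trans h2.le⟩, b⟩
      rw [heq]
      refine ((h T' h2).continuous t ⟨ht.1, h1.le⟩).congr' ?_
      filter_upwards [self_mem_nhdsWithin] with q hq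
      rw [hupd q (hq.2.trans_lt h2).ne]
  · rw [← restrict_Ico_eq_restrict_Icc]
    filter_upwards [ae_mem_of_forall_lt h, ae_restrict_of_ae hne] with t ht htT
    rwa [hupd t htT]
  · rw [integrableOn_Icc_iff_integrableOn_Ico]
    exact (hF.integrableOn_rate hT h hψ hψc).congr (ae_restrict_of_ae (hrate ψ))
  · have hint : IntegrableOn (fun t => ∫ x, fderiv ℝ ψ x (v t x) ∂(c t).meas) (Icc 0 T) := by
      rw [integrableOn_Icc_iff_integrableOn_Ico]
      exact hF.integrableOn_rate hT h hψ hψc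
    have hii : ∀ t ∈ Icc 0 T, IntervalIntegrable
        (fun t => ∫ x, fderiv ℝ ψ x (v t x) ∂(c t).meas) volume 0 t := fun t ht => by
      rw [intervalIntegrable_iff_integrableOn_Icc_of_le ht.1]
      exact hint.mono_set (Icc_subset_Icc_right ht.2)
    have key : ∀ t ∈ Icc 0 T, ∫ x, ψ x ∂(Function.update c T ν t).meas =
        ∫ x, ψ x ∂(c 0).meas + ∫ τ in 0..t, ∫ x, fderiv ℝ ψ x (v τ x) ∂(c τ).meas := by
      intro t ht
      rcases eq_or_lt_of_le ht.2 with rfl | htT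
      · rw [Function.update_self]; exact (hν ψ hψ hψc).2
      · rw [hupd t htT.ne, ← (h t htT).weak ψ hψ hψc 0 ⟨le_rfl, ht.1⟩ t ⟨ht.1, le_rfl⟩]
        ring
    intro s hs t ht
    rw [key s hs, key t ht, add_sub_add_left_eq_sub,
      intervalIntegral.integral_interval_sub_left (hii t ht) (hii s hs)]
    exact intervalIntegral.integral_congr_ae ((hrate ψ).mono fun τ hτ _ => hτ)

end Limit

/-! ### Concatenation of admissible curves -/

section Concatenation

variable {d : ℕ} {F : P2 d → E d → Set (E d)}

theorem isDrivenBy_singleton (a : ℝ) (c : ℝ → P2 d) {v : ℝ → E d → E d}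
    (hv : Measurable (Function.uncurry v)) : IsDrivenBy F a a c v where
  continuous t ht := by
    rw [Icc_self] at ht ⊢
    obtain rfl : t = a := ht
    rw [nhdsWithin_singleton, tendsto_pure_left]
    intro s hs
    rw [W2_self]
    exact mem_of_mem_nhds hs
  measurable := hv
  mem := by simp
  integrableOn ψ _ _ := by simp
  weak ψ _ _ s hs t ht := by
    rw [Icc_self] at hs ht
    obtain rfl : s = a := hs
    obtain rfl : t = s := ht
    simp

/-- The velocities need to agree only on the open interval, since endpoints are negligible.
Velocities on successive intervals can thus be glued without matching at the junctions. -/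
theorem IsDrivenBy.congr {a b : ℝ} {c c' : ℝ → P2 d} {v v' : ℝ → E d → E d}
    (h : IsDrivenBy F a b c v) (hc : EqOn c' c (Icc a b)) (hv' : Measurable (Function.uncurry v'))
    (hv : EqOn v' v (Ioo a b)) : IsDrivenBy F a b c' v' := by
  have hae : ∀ᵐ t ∂(volume.restrict (Icc a b)), c' t = c t ∧ v' t = v t := by
    rw [← restrict_Ioo_eq_restrict_Icc]
    filter_upwards [ae_restrict_mem measurableSet_Ioo] with t ht
    exact ⟨hc (Ioo_subset_Icc_self ht), hv ht⟩
  refine ⟨fun t ht => ?_, hv', ?_, fun ψ h1 h2 => ?_, fun ψ h1 h2 s hs t ht => ?_⟩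
  · rw [hc ht]
    refine (h.continuous t ht).congr' ?_
    filter_upwards [self_mem_nhdsWithin] with s hs
    rw [hc hs]
  · filter_upwards [h.mem, hae] with t ht he
    rwa [he.1, he.2]
  · refine (h.integrableOn ψ h1 h2).congr ?_
    filter_upwards [hae] with t he
    rw [he.1, he.2]
  · rw [hc hs, hc ht, h.weak ψ h1 h2 s hs t ht]
    refine intervalIntegral.integral_congr_ae ?_
    filter_upwards [(ae_restrict_iff' measurableSet_Icc).1 hae] with τ hτ hm
    have hm' : τ ∈ Icc a b := by
      have := uIoc_subset_uIcc hm
      exact uIcc_subset_Icc hs ht this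
    rw [(hτ hm').1, (hτ hm').2]

theorem IsDrivenBy.shift {h : ℝ} {c : ℝ → P2 d} {v : ℝ → E d → E d}
    (hd : IsDrivenBy F 0 h c v) (s : ℝ) :
    IsDrivenBy F s (s + h) (fun t => c (t - s)) (fun t => v (t - s)) := by
  have hpre : (fun t => t - s) ⁻¹' Icc 0 h = Icc s (s + h) := by
    rw [preimage_sub_const_Icc, zero_add, add_comm]
  have hmp : MeasurePreserving (fun t : ℝ => t - s) volume volume :=
    measurePreserving_sub_right volume s
  have hmem : ∀ {t}, t ∈ Icc s (s + h) → t - s ∈ Icc 0 h := fun {t} ht => by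
    rw [← hpre] at ht; exact ht
  refine ⟨fun t ht => ?_, ?_, ?_, fun ψ h1 h2 => ?_, fun ψ h1 h2 q hq t ht => ?_⟩
  · refine (hd.continuous (t - s) (hmem ht)).comp ?_
    exact ((continuous_id.sub continuous_const).continuousWithinAt).tendsto_nhdsWithin
      fun q hq => hmem hq
  · exact hd.measurable.comp ((measurable_fst.sub_const s).prodMk measurable_snd)
  · have := (hmp.restrict_preimage (s := Icc 0 h) measurableSet_Icc).quasiMeasurePreserving.ae hd.mem
    rwa [hpre] at this
  · have := (hmp.integrableOn_comp_preimage
      (MeasurableEquiv.subRight s).measurableEmbedding (s := Icc 0 h)).2 (hd.integrableOn ψ h1 h2)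
    rwa [hpre] at this
  · rw [hd.weak ψ h1 h2 _ (hmem hq) _ (hmem ht)]
    exact (intervalIntegral.integral_comp_sub_right
      (fun τ => ∫ x, fderiv ℝ ψ x (v τ x) ∂(c τ).meas) s).symm

theorem IsDrivenBy.trans {a b e : ℝ} {c : ℝ → P2 d} {v : ℝ → E d → E d}
    (h₁ : IsDrivenBy F a b c v) (h₂ : IsDrivenBy F b e c v) (hab : a ≤ b) (hbe : b ≤ e) :
    IsDrivenBy F a e c v := by
  have hU : Icc a e = Icc a b ∪ Icc b e := (Icc_union_Icc_eq_Icc hab hbe).symm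
  have hint : ∀ ψ : E d → ℝ, ContDiff ℝ 1 ψ → HasCompactSupport ψ →
      IntegrableOn (fun t => ∫ x, fderiv ℝ ψ x (v t x) ∂(c t).meas) (Icc a e) :=
    fun ψ h1 h2 => by
      rw [hU]
      exact (h₁.integrableOn ψ h1 h2).union (h₂.integrableOn ψ h1 h2)
  refine ⟨fun t ht => ?_, h₁.measurable, ?_, hint, fun ψ h1 h2 => ?_⟩
  · have side : ∀ p q, (t ∈ Icc p q →
        Tendsto (fun s => W2 (c s) (c t)) (𝓝[Icc p q] t) (𝓝 0)) →
        Tendsto (fun s => W2 (c s) (c t)) (𝓝[Icc p q] t) (𝓝 0) := by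
      intro p q hpq
      by_cases htm : t ∈ Icc p q
      · exact hpq htm
      · have : 𝓝[Icc p q] t = ⊥ := by
          rwa [← isClosed_Icc.closure_eq (s := Icc p q), mem_closure_iff_nhdsWithin_neBot,
            not_neBot] at htm
        rw [this]
        exact tendsto_bot
    rw [hU, nhdsWithin_union, tendsto_sup]
    exact ⟨side _ _ (h₁.continuous t), side _ _ (h₂.continuous t)⟩
  · rw [hU, ae_restrict_union_iff]
    exact ⟨h₁.mem, h₂.mem⟩
  · have hii : ∀ t ∈ Icc a e, IntervalIntegrable
        (fun t => ∫ x, fderiv ℝ ψ x (v t x) ∂(c t).meas) volume a t := fun t ht => by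
      rw [intervalIntegrable_iff_integrableOn_Icc_of_le ht.1]
      exact (hint ψ h1 h2).mono_set (Icc_subset_Icc_right ht.2)
    have key : ∀ t ∈ Icc a e, ∫ x, ψ x ∂(c t).meas =
        ∫ x, ψ x ∂(c a).meas + ∫ τ in a..t, ∫ x, fderiv ℝ ψ x (v τ x) ∂(c τ).meas := by
      intro t ht
      rcases le_total t b with htb | htb
      · rw [← h₁.weak ψ h1 h2 a ⟨le_rfl, hab⟩ t ⟨ht.1, htb⟩]; ring
      · have e1 := h₁.weak ψ h1 h2 a ⟨le_rfl, hab⟩ b ⟨hab, le_rfl⟩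
        have e2 := h₂.weak ψ h1 h2 b ⟨le_rfl, hbe⟩ t ⟨htb, ht.2⟩
        rw [← intervalIntegral.integral_interval_sub_left (hii t ht) (hii b ⟨hab, hbe⟩)] at e2
        linarith
    intro s hs t ht
    rw [key s hs, key t ht, add_sub_add_left_eq_sub,
      intervalIntegral.integral_interval_sub_left (hii t ht) (hii s hs)]

/-- Functions on successive closed intervals that match at the endpoints have a common
extension. -/
theorem exists_eqOn_Icc {X : Type*} {S : ℕ → ℝ} (hS : Monotone S) {g : ℕ → ℝ → X}
    (hg : ∀ i, g i (S (i + 1)) = g (i + 1) (S (i + 1))) :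
    ∃ f : ℝ → X, ∀ i, EqOn f (g i) (Icc (S i) (S (i + 1))) := by
  classical
  -- A point of two of the intervals is the junction of all those between them; intervals of length
  -- zero are allowed.
  have key : ∀ i j t, i ≤ j → t ∈ Icc (S i) (S (i + 1)) → t ∈ Icc (S j) (S (j + 1)) →
      g i t = g j t := by
    intro i j t hij hi
    induction j, hij using Nat.le_induction with
    | base => exact fun _ => rfl
    | succ j hij ih =>
      intro hj
      have h1 : t = S (j + 1) :=
        le_antisymm (hi.2.trans (hS (Nat.succ_le_succ hij))) hj.1
      rw [ih ⟨(hS (Nat.le_succ j)).trans hj.1, h1.le⟩, h1, hg]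
  let f : ℝ → X := fun t =>
    if h : ∃ i, t ∈ Icc (S i) (S (i + 1)) then g (Nat.find h) t else g 0 t
  refine ⟨f, fun i t ht => ?_⟩
  have h : ∃ i, t ∈ Icc (S i) (S (i + 1)) := ⟨i, ht⟩
  change (if h : ∃ i, t ∈ Icc (S i) (S (i + 1)) then g (Nat.find h) t else g 0 t) = _
  rw [dif_pos h]
  exact key _ _ _ (Nat.find_min' h ht) (Nat.find_spec h) ht

/-- Concatenation of countably many admissible curves. -/
theorem exists_concatenation {μ : ℕ → P2 d} {τ : ℕ → ℝ} (hτ : ∀ i, 0 ≤ τ i)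
    (h : ∀ i, ∃ c ∈ Adm F 0 (τ i) (μ i), c (τ i) = μ (i + 1)) :
    ∃ (c : ℝ → P2 d) (v : ℝ → E d → E d), ∀ n,
      IsDrivenBy F 0 (∑ i ∈ Finset.range n, τ i) c v ∧ c (∑ i ∈ Finset.range n, τ i) = μ n := by
  choose c hc hend using h
  choose v hv using fun i => isAdmissible_iff.1 (hc i).1
  have hstart : ∀ i, c i 0 = μ i := fun i => (hc i).2
  set S : ℕ → ℝ := fun n => ∑ i ∈ Finset.range n, τ i with hSdef
  have hSs : ∀ n, S (n + 1) = S n + τ n := fun n => Finset.sum_range_succ _ _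
  have hS : Monotone S := monotone_nat_of_le_succ fun n => by rw [hSs]; linarith [hτ n]
  obtain ⟨f, hf⟩ := exists_eqOn_Icc hS (g := fun i t => c i (t - S i)) fun i => by
    simp only [sub_self, hstart, hSs i, add_sub_cancel_left, hend]
  -- The open intervals are pairwise disjoint, so the compatibility condition for the measurable
  -- gluing is vacuous.
  obtain ⟨w, hw, hwe⟩ := exists_measurable_piecewise
    (fun i => Ioo (S i) (S (i + 1)) ×ˢ (univ : Set (E d)))
    (fun i => measurableSet_Ioo.prod MeasurableSet.univ)
    (fun i => Function.uncurry fun t => v i (t - S i)) (fun i => ((hv i).shift (S i)).measurable)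
    (fun i j hij => by
      have : Disjoint (Ioo (S i) (S (i + 1))) (Ioo (S j) (S (j + 1))) :=
        hS.pairwise_disjoint_on_Ioo_succ hij
      intro z hz
      exact absurd hz.2.1 (disjoint_left.1 this hz.1.1))
  have hwu : Function.uncurry (Function.curry w) = w := Function.uncurry_curry w
  refine ⟨f, Function.curry w, fun n => ?_⟩
  have hfS : ∀ n, f (S n) = μ n := fun n => by
    rw [hf n ⟨le_rfl, hS (Nat.le_succ n)⟩]
    simp only [sub_self, hstart]
  refine ⟨?_, hfS n⟩
  change IsDrivenBy F 0 (S n) f (Function.curry w)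
  induction n with
  | zero =>
    have h0 : S 0 = 0 := by simp [hSdef]
    rw [h0]
    exact isDrivenBy_singleton 0 f (by rwa [hwu])
  | succ n ih =>
    refine ih.trans ?_ ?_ (hS (Nat.le_succ n))
    · have := (hv n).shift (S n)
      rw [← hSs] at this
      refine this.congr (hf n) (by rwa [hwu]) fun t ht => ?_
      ext1 x
      exact hwe n ⟨ht, mem_univ x⟩
    · have h0 : S 0 = 0 := by simp [hSdef]
      rw [← h0]
      exact hS (Nat.zero_le n)

end Concatenation

/-! ### Decrease of the observable along one step -/

section Descent

theorem memLp_two_integrable_inner {Ω G : Type*} [MeasurableSpace Ω] {μ : Measure Ω}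
    [NormedAddCommGroup G] [InnerProductSpace ℝ G] {f g : Ω → G} (hf : MemLp f 2 μ)
    (hg : MemLp g 2 μ) : Integrable (fun x => inner ℝ (f x) (g x)) μ := by
  refine (L2.integrable_inner (𝕜 := ℝ) (hf.toLp f) (hg.toLp g)).congr ?_
  filter_upwards [hf.coeFn_toLp, hg.coeFn_toLp] with x h1 h2
  rw [h1, h2]

theorem inner_toLp_eq_integral {Ω G : Type*} [MeasurableSpace Ω] {μ : Measure Ω}
    [NormedAddCommGroup G] [InnerProductSpace ℝ G] {f g : Ω → G} (hf : MemLp f 2 μ)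
    (hg : MemLp g 2 μ) : inner ℝ (hf.toLp f) (hg.toLp g) = ∫ x, inner ℝ (f x) (g x) ∂μ := by
  rw [L2.inner_def]
  refine integral_congr_ae ?_
  filter_upwards [hf.coeFn_toLp, hg.coeFn_toLp] with x h1 h2
  rw [h1, h2]

theorem integral_inner_le_eLpNorm_mul {Ω G : Type*} [MeasurableSpace Ω] {μ : Measure Ω}
    [NormedAddCommGroup G] [InnerProductSpace ℝ G] {f g : Ω → G} (hf : MemLp f 2 μ)
    (hg : MemLp g 2 μ) :
    ∫ x, inner ℝ (f x) (g x) ∂μ ≤ (eLpNorm f 2 μ).toReal * (eLpNorm g 2 μ).toReal := by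
  rw [← inner_toLp_eq_integral hf hg, ← Lp.norm_toLp f hf, ← Lp.norm_toLp g hg]
  exact real_inner_le_norm _ _

theorem integral_norm_sq_eq_eLpNorm_sq {Ω G : Type*} [MeasurableSpace Ω] {μ : Measure Ω}
    [NormedAddCommGroup G] [InnerProductSpace ℝ G] {f : Ω → G} (hf : MemLp f 2 μ) :
    ∫ x, ‖f x‖ ^ 2 ∂μ = (eLpNorm f 2 μ).toReal ^ 2 := by
  rw [← Lp.norm_toLp f hf, ← real_inner_self_eq_norm_sq, inner_toLp_eq_integral hf hf]
  simp_rw [real_inner_self_eq_norm_sq]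

theorem measurable_evalCurve {d : ℕ} {T : ℝ} (t : ℝ) :
    Measurable fun z : E d × Curves d T => evalCurve z.2 t := by
  unfold evalCurve
  split_ifs with h
  · exact (continuous_eval_const (F := Curves d T) (⟨t, h⟩ : Icc (0 : ℝ) T)).measurable.comp
      measurable_snd
  · exact measurable_const

/-- The displacement is `s (Δ + v)`. The global proximal inequality is integrated, with
Cauchy–Schwarz for `⟨ξ, Δ⟩` and `|Δ + v|² ≤ 2 (|Δ|² + |v|²)` for the quadratic term. -/
theorem SemiconcaveWith.integral_sub_le {d : ℕ} {φ : E d →ᵇ ℝ} {C : ℝ} (hφ : SemiconcaveWith φ C)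
    (hC : 0 ≤ C) {Ω : Type*} [MeasurableSpace Ω] {P : Measure Ω} {X₀ X₁ : Ω → E d}
    (hX₀m : Measurable X₀) (hX₁m : Measurable X₁) {μ ν : P2 d} (hmap₀ : P.map X₀ = μ.meas)
    (hmap₁ : P.map X₁ = ν.meas) {v ξ : E d → E d} (hv : MemLp v 2 μ.meas) (hξ : MemLp ξ 2 μ.meas)
    (hprox : ∀ᵐ x ∂μ.meas, ξ x ∈ proxSuperdiff φ x) {C₂ C₄ δ s : ℝ} (hδ : 0 ≤ δ) (hC₄ : 0 ≤ C₄)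
    (hs0 : 0 < s) (hdesc : ∫ x, inner ℝ (ξ x) (v x) ∂μ.meas ≤ -C₂)
    (hΔ : eLpNorm (fun z => s⁻¹ • (X₁ z - X₀ z) - v (X₀ z)) 2 P ≤ ENNReal.ofReal δ)
    (hvn : eLpNorm v 2 μ.meas ≤ ENNReal.ofReal C₄) :
    ∫ x, φ x ∂ν.meas - ∫ x, φ x ∂μ.meas ≤
      s * ((eLpNorm ξ 2 μ.meas).toReal * δ) + s * (-C₂) + 2 * C * s ^ 2 * (δ ^ 2 + C₄ ^ 2) := by
  set Δ : Ω → E d := fun z => s⁻¹ • (X₁ z - X₀ z) - v (X₀ z) with hΔdef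
  have hmp : MeasurePreserving X₀ P μ.meas := ⟨hX₀m, hmap₀⟩
  have hv₀ := hv.comp_measurePreserving hmp
  have hξ₀ := hξ.comp_measurePreserving hmp
  have hΔL : MemLp Δ 2 P := by
    refine ⟨?_, hΔ.trans_lt ENNReal.ofReal_lt_top⟩
    have hm : Measurable fun z => s⁻¹ • (X₁ z - X₀ z) := by fun_prop
    have hv' : AEStronglyMeasurable (fun z => v (X₀ z)) P := hv₀.1
    exact hm.aestronglyMeasurable.sub hv'
  have hdiff : ∀ z, X₁ z - X₀ z = s • (Δ z + v (X₀ z)) := fun z => by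
    simp only [hΔdef, sub_add_cancel]
    rw [smul_smul, mul_inv_cancel₀ hs0.ne', one_smul]
  have hpt : ∀ᵐ z ∂P, φ (X₁ z) - φ (X₀ z) ≤
      s * inner ℝ (ξ (X₀ z)) (Δ z) + s * inner ℝ (ξ (X₀ z)) (v (X₀ z)) +
        2 * C * s ^ 2 * (‖Δ z‖ ^ 2 + ‖v (X₀ z)‖ ^ 2) := by
    filter_upwards [hmp.quasiMeasurePreserving.ae hprox] with z hz
    refine (hφ.le_of_mem_proxSuperdiff hz (X₁ z)).trans ?_
    rw [hdiff, inner_smul_right, inner_add_right, norm_smul, Real.norm_of_nonneg hs0.le, mul_pow]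
    have h1 : ‖Δ z + v (X₀ z)‖ ^ 2 ≤ 2 * (‖Δ z‖ ^ 2 + ‖v (X₀ z)‖ ^ 2) := by
      have := norm_add_le (Δ z) (v (X₀ z))
      nlinarith [norm_nonneg (Δ z + v (X₀ z)), sq_nonneg (‖Δ z‖ - ‖v (X₀ z)‖),
        norm_nonneg (Δ z), norm_nonneg (v (X₀ z))]
    have h2 := mul_le_mul_of_nonneg_left h1 (mul_nonneg hC (sq_nonneg s))
    nlinarith
  have hi₁ : Integrable (fun z => φ (X₁ z)) P := by
    have := φ.integrable ν.meas
    rw [← hmap₁] at this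
    exact this.comp_measurable hX₁m
  have hi₀ : Integrable (fun z => φ (X₀ z)) P := by
    have := φ.integrable μ.meas
    rw [← hmap₀] at this
    exact this.comp_measurable hX₀m
  have hA : Integrable (fun z => s * inner ℝ (ξ (X₀ z)) (Δ z)) P :=
    (memLp_two_integrable_inner hξ₀ hΔL).const_mul s
  have hB : Integrable (fun z => s * inner ℝ (ξ (X₀ z)) (v (X₀ z))) P :=
    (memLp_two_integrable_inner hξ₀ hv₀).const_mul s
  have hΔ2 := hΔL.integrable_norm_pow (by norm_num)
  have hv2 : Integrable (fun z => ‖v (X₀ z)‖ ^ 2) P := hv₀.integrable_norm_pow (by norm_num)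
  have hint := integral_mono_ae (hi₁.sub hi₀)
    ((hA.add hB).add ((hΔ2.add hv2).const_mul (2 * C * s ^ 2))) hpt
  have e1 : ∫ z, (φ (X₁ z) - φ (X₀ z)) ∂P =
      ∫ x, φ x ∂ν.meas - ∫ x, φ x ∂μ.meas := by
    rw [integral_sub hi₁ hi₀, ← hmap₁, ← hmap₀,
      integral_map hX₁m.aemeasurable φ.continuous.aestronglyMeasurable,
      integral_map hX₀m.aemeasurable φ.continuous.aestronglyMeasurable]
  have e2 : ∫ z, inner ℝ (ξ (X₀ z)) (v (X₀ z)) ∂P =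
      ∫ x, inner ℝ (ξ x) (v x) ∂μ.meas := by
    have hm : AEStronglyMeasurable (fun x => inner ℝ (ξ x) (v x))
        (P.map X₀) := by
      rw [hmap₀]; exact hξ.1.inner hv.1
    rw [← hmap₀, integral_map hX₀m.aemeasurable hm]
  have e3 : ∫ z, inner ℝ (ξ (X₀ z)) (Δ z) ∂P ≤
      (eLpNorm ξ 2 μ.meas).toReal * δ := by
    refine (integral_inner_le_eLpNorm_mul hξ₀ hΔL).trans ?_
    rw [eLpNorm_comp_measurePreserving hξ.1 hmp]
    gcongr
    exact ENNReal.toReal_le_of_le_ofReal (by positivity) hΔ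
  have e4 : ∫ z, ‖Δ z‖ ^ 2 ∂P ≤ δ ^ 2 := by
    rw [integral_norm_sq_eq_eLpNorm_sq hΔL]
    gcongr
    exact ENNReal.toReal_le_of_le_ofReal (by positivity) hΔ
  have e5 : ∫ z, ‖v (X₀ z)‖ ^ 2 ∂P ≤ C₄ ^ 2 := by
    have := integral_norm_sq_eq_eLpNorm_sq hv₀
    rw [eLpNorm_comp_measurePreserving hv.1 hmp] at this
    simp only [Function.comp_apply] at this
    rw [this]
    gcongr
    exact ENNReal.toReal_le_of_le_ofReal hC₄ hvn
  have hsplit : ∫ z, (s * inner ℝ (ξ (X₀ z)) (Δ z) + s * inner ℝ (ξ (X₀ z)) (v (X₀ z)) +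
        2 * C * s ^ 2 * (‖Δ z‖ ^ 2 + ‖v (X₀ z)‖ ^ 2)) ∂P =
      s * ∫ z, inner ℝ (ξ (X₀ z)) (Δ z) ∂P +
      s * ∫ z, inner ℝ (ξ (X₀ z)) (v (X₀ z)) ∂P +
      2 * C * s ^ 2 * (∫ z, ‖Δ z‖ ^ 2 ∂P +
        ∫ z, ‖v (X₀ z)‖ ^ 2 ∂P) := by
    rw [← integral_const_mul, ← integral_const_mul, ← integral_add hΔ2 hv2, ← integral_const_mul,
      ← integral_add hA hB]
    exact integral_add (hA.add hB) ((hΔ2.add hv2).const_mul _)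
  rw [← e1]
  refine hint.trans (hsplit.le.trans ?_)
  rw [e2]
  gcongr

theorem DescentAt.exists_step {d : ℕ} {F : P2 d → E d → Set (E d)} {φ : E d →ᵇ ℝ}
    {D : Set (P2 d)} {L C α β K : ℝ} {μ : P2 d} (h : DescentAt F φ D L C α β K μ)
    (hC : 0 ≤ C) (hφ : SemiconcaveWith φ C) (hT : 0 < stepTime {φ} L β μ) :
    ∃ c ∈ Adm F 0 (stepTime {φ} L β μ) μ, c (stepTime {φ} L β μ) ∈ D ∧
      ∫ x, φ x ∂(c (stepTime {φ} L β μ)).meas ≤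
        ∫ x, φ x ∂μ.meas - 2 * K * stepTime {φ} L β μ ^ (α + 2) := by
  unfold DescentAt at h
  -- The type of `η` depends on the time step, which therefore has to be generalized before the data
  -- are unpacked.
  generalize stepTime {φ} L β μ = T at h hT ⊢
  obtain ⟨v, ξ, η, C₂, C₃, C₄, -, hC₃, hC₄, hv, hξ, ⟨c, hc, hcη, hcD⟩, hprox, hdesc, hΔ, hvn,
    hineq⟩ := h
  refine ⟨c, hc, hcD, ?_⟩
  have hs0 : 0 < T ^ (1 + α) := Real.rpow_pos_of_pos hT _
  have hstep := hφ.integral_sub_le hC (measurable_evalCurve 0) (measurable_evalCurve T)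
    (μ := μ) (ν := c T) (by rw [← hcη 0 ⟨le_rfl, hT.le⟩, hc.2]) (hcη T ⟨hT.le, le_rfl⟩).symm
    hv hξ hprox (δ := C₃ * T) (by positivity) hC₄.le hs0 hdesc hΔ hvn
  rw [add_comm α 1] at hineq
  have hpow : T ^ (α + 2) = T ^ (1 + α) * T := by
    rw [← Real.rpow_add_one hT.ne']; ring_nf
  -- Multiplied by `T ^ (1 + α)`, the last inequality of the descent condition bounds the right-hand
  -- side of `hstep` by `-2 K T ^ (α + 2)`.
  have := mul_le_mul_of_nonneg_left hineq hs0.le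
  rw [hpow]
  linarith

end Descent

/-! ### The explicit bound -/

section TimeBound

/-- The time step as a function of the value of the observable. -/
noncomputable def stepFun (L β q : ℝ) : ℝ := min 1 (min (1 / (2 * L)) (q ^ (1 / β)))

/-- The bound for small arguments. -/
noncomputable def powerBound (α β K q : ℝ) : ℝ := β * q ^ ((β - α - 1) / β) / (K * (β - α - 1))

variable {L α β K : ℝ}

/-- The tangent inequality at `a` of a concave power, obtained from Bernoulli's inequality with
exponent `(β - α - 1) / β` in `[0, 1]`. The derivative at `a` is `a ^ (-(α + 1) / β) / K`. -/
theorem powerBound_tangent (hα : 0 ≤ α) (hαβ : α < β - 1) (hK : 0 < K) {a b : ℝ} (ha : 0 < a)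
    (hb : 0 ≤ b) :
    powerBound α β K b + (a - b) * (K * (a ^ (1 / β)) ^ (α + 1))⁻¹ ≤ powerBound α β K a := by
  have hβ : 0 < β := by linarith
  have hγ : 0 < β - α - 1 := by linarith
  set p := (β - α - 1) / β with hp
  have hp0 : 0 ≤ p := by positivity
  have hp1 : p ≤ 1 := by rw [hp, div_le_one hβ]; linarith
  have hbern := rpow_one_add_le_one_add_mul_self (s := b / a - 1) (p := p)
    (by linarith [div_nonneg hb ha.le]) hp0 hp1
  have e1 : b ^ p = a ^ p * (b / a) ^ p := by
    rw [← Real.mul_rpow ha.le (div_nonneg hb ha.le), mul_div_cancel₀ _ ha.ne']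
  have e2 : ((a ^ (1 / β)) ^ (α + 1))⁻¹ = a ^ p / a := by
    rw [← Real.rpow_mul ha.le, ← Real.rpow_neg ha.le, ← Real.rpow_sub_one ha.ne']
    congr 1
    rw [hp]; field_simp; ring
  have hap : 0 < a ^ p := Real.rpow_pos_of_pos ha p
  have h1 : b ^ p ≤ a ^ p + p * (a ^ p / a) * (b - a) := by
    rw [add_sub_cancel] at hbern
    rw [e1]
    calc a ^ p * (b / a) ^ p ≤ a ^ p * (1 + p * (b / a - 1)) := by gcongr
      _ = _ := by field_simp
  rw [mul_inv, e2]
  simp only [powerBound, ← hp]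
  have h2 : β * b ^ p / (K * (β - α - 1)) ≤
      β * (a ^ p + p * (a ^ p / a) * (b - a)) / (K * (β - α - 1)) := by gcongr
  have h3 : β * (a ^ p + p * (a ^ p / a) * (b - a)) / (K * (β - α - 1)) =
      β * a ^ p / (K * (β - α - 1)) - (a - b) * (K⁻¹ * (a ^ p / a)) := by
    have hpβ : p * β = β - α - 1 := by rw [hp]; field_simp
    rw [← hpβ]
    have hp' : p ≠ 0 := by rw [hp]; positivity
    field_simp
    ring
  linarith

theorem min_rpow_eq (hL : 0 < L) (hβ : 0 < β) :
    min 1 ((2 * L) ^ (-β)) = min 1 (1 / (2 * L)) ^ β := by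
  have h2L : 0 < 2 * L := by positivity
  have e : (2 * L) ^ (-β) = (1 / (2 * L)) ^ β := by
    rw [Real.rpow_neg h2L.le, one_div, Real.inv_rpow h2L.le]
  rw [e]
  rcases le_total 1 (1 / (2 * L)) with h | h
  · rw [min_eq_left h, Real.one_rpow, min_eq_left (Real.one_le_rpow h hβ.le)]
  · rw [min_eq_right h, min_eq_right (Real.rpow_le_one (by positivity) h hβ.le)]

/-- With `m = min 1 (1 / (2 L))`, the three cases are one function: the power up to `m ^ β`,
continued by a line of slope `1 / (K m ^ (α + 1))`, the derivative of the power there. -/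
theorem timeBound_eq (hL : 0 < L) (hα : 0 ≤ α) (hαβ : α < β - 1) (q : ℝ) :
    timeBound L α β K q = powerBound α β K (min q (min 1 (1 / (2 * L)) ^ β)) +
      (q - min q (min 1 (1 / (2 * L)) ^ β)) * (K * min 1 (1 / (2 * L)) ^ (α + 1))⁻¹ := by
  have hβ : 0 < β := by linarith
  have h2L : 0 < 2 * L := by positivity
  have hmin := min_rpow_eq (β := β) hL hβ
  unfold timeBound
  split_ifs with h1 h2
  · rw [hmin] at h1
    rw [min_eq_left h1, sub_self, zero_mul, add_zero, powerBound]
  · rw [not_le] at h1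
    have h1' := h1.le
    rw [hmin] at h1'
    rw [min_eq_right h1', ← hmin, min_eq_right h2]
    have h3 : 1 / (2 * L) ≤ 1 := by
      by_contra hcon
      rw [not_le] at hcon
      have e : (2 * L) ^ (-β) = (1 / (2 * L)) ^ β := by
        rw [Real.rpow_neg h2L.le, one_div, Real.inv_rpow h2L.le]
      rw [e] at h2
      exact absurd (Real.one_lt_rpow hcon hβ) (not_lt.2 h2)
    rw [min_eq_right h3, powerBound, ← Real.rpow_mul h2L.le, one_div (2 * L),
      Real.inv_rpow h2L.le, mul_inv, inv_inv]
    have : -β * ((β - α - 1) / β) = -β + α + 1 := by field_simp; ring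
    rw [this]
    ring
  · rw [not_le] at h1 h2
    have h1' := h1.le
    rw [hmin] at h1'
    rw [min_eq_right h1', ← hmin, min_eq_left h2.le]
    have h3 : 1 ≤ 1 / (2 * L) := by
      by_contra hcon
      rw [not_le] at hcon
      have e : (2 * L) ^ (-β) = (1 / (2 * L)) ^ β := by
        rw [Real.rpow_neg h2L.le, one_div, Real.inv_rpow h2L.le]
      rw [e] at h2
      exact absurd (Real.rpow_lt_one (by positivity) hcon hβ) (not_lt.2 h2.le)
    rw [min_eq_left h3, powerBound, Real.one_rpow, Real.one_rpow]
    ring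

theorem stepFun_pos (hL : 0 < L) {q : ℝ} (hq : 0 < q) : 0 < stepFun L β q :=
  lt_min one_pos (lt_min (by positivity) (Real.rpow_pos_of_pos hq _))

theorem stepFun_nonneg (hL : 0 < L) {q : ℝ} (hq : 0 ≤ q) : 0 ≤ stepFun L β q :=
  le_min zero_le_one (le_min (by positivity) (Real.rpow_nonneg hq _))

theorem stepFun_mono (hβ : 0 < β) {p q : ℝ} (hp : 0 ≤ p) (hpq : p ≤ q) :
    stepFun L β p ≤ stepFun L β q :=
  min_le_min le_rfl (min_le_min le_rfl (Real.rpow_le_rpow hp hpq (by positivity)))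

theorem timeBound_tangent (hL : 0 < L) (hα : 0 ≤ α) (hαβ : α < β - 1) (hK : 0 < K) {p q : ℝ}
    (hp : 0 ≤ p) (hpq : p ≤ q) (hq : 0 < q) :
    timeBound L α β K p + (q - p) * (K * stepFun L β q ^ (α + 1))⁻¹ ≤ timeBound L α β K q := by
  have hβ : 0 < β := by linarith
  rw [timeBound_eq hL hα hαβ, timeBound_eq hL hα hαβ, stepFun, ← min_assoc]
  set m := min 1 (1 / (2 * L)) with hm
  have hm0 : 0 < m := lt_min one_pos (by positivity)
  have hr : (m ^ β) ^ (1 / β) = m := by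
    rw [← Real.rpow_mul hm0.le, mul_one_div_cancel hβ.ne', Real.rpow_one]
  have hmβ : 0 < m ^ β := Real.rpow_pos_of_pos hm0 β
  rcases le_total q (m ^ β) with h | h
  · have h1 : q ^ (1 / β) ≤ m := by
      have := Real.rpow_le_rpow hq.le h (by positivity : 0 ≤ 1 / β)
      rwa [hr] at this
    rw [min_eq_left h, min_eq_left (hpq.trans h), min_eq_right h1]
    simpa using powerBound_tangent hα hαβ hK hq hp
  · have h1 : m ≤ q ^ (1 / β) := by
      have := Real.rpow_le_rpow hmβ.le h (by positivity : 0 ≤ 1 / β)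
      rwa [hr] at this
    rw [min_eq_right h, min_eq_left h1]
    rcases le_total p (m ^ β) with h' | h'
    · rw [min_eq_left h']
      have := powerBound_tangent hα hαβ hK hmβ hp
      rw [hr] at this
      linarith
    · rw [min_eq_right h']
      linarith

theorem timeBound_zero (hL : 0 < L) (hα : 0 ≤ α) (hαβ : α < β - 1) :
    timeBound L α β K 0 = 0 := by
  have hβ : 0 < β := by linarith
  have hγ : (β - α - 1) / β ≠ 0 := by
    have : 0 < β - α - 1 := by linarith
    positivity
  have : 0 ≤ min 1 (1 / (2 * L)) ^ β := Real.rpow_nonneg (by positivity) _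
  rw [timeBound_eq hL hα hαβ, min_eq_left this, powerBound, Real.zero_rpow hγ]
  simp

theorem mul_inv_stepFun_le_timeBound (hL : 0 < L) (hα : 0 ≤ α) (hαβ : α < β - 1) (hK : 0 < K)
    {q : ℝ} (hq : 0 < q) : q * (K * stepFun L β q ^ (α + 1))⁻¹ ≤ timeBound L α β K q := by
  have := timeBound_tangent hL hα hαβ hK le_rfl hq.le hq
  rwa [timeBound_zero hL hα hαβ, zero_add, sub_zero] at this

theorem timeBound_nonneg (hL : 0 < L) (hα : 0 ≤ α) (hαβ : α < β - 1) (hK : 0 < K) {q : ℝ}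
    (hq : 0 ≤ q) : 0 ≤ timeBound L α β K q := by
  rcases hq.eq_or_lt with rfl | hq
  · exact (timeBound_zero hL hα hαβ).ge
  · refine le_trans ?_ (mul_inv_stepFun_le_timeBound hL hα hαβ hK hq)
    have := stepFun_pos (β := β) hL hq
    positivity

/-- A decrease by `2 K t ^ (α + 2)` of the observable pays for twice the time step `t`. -/
theorem two_mul_stepFun_add_timeBound_le (hL : 0 < L) (hα : 0 ≤ α) (hαβ : α < β - 1) (hK : 0 < K)
    {p q : ℝ} (hp : 0 ≤ p) (hq : 0 < q) (h : p ≤ q - 2 * K * stepFun L β q ^ (α + 2)) :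
    2 * stepFun L β q + timeBound L α β K p ≤ timeBound L α β K q := by
  have ht := stepFun_pos (β := β) hL hq
  set t := stepFun L β q with htdef
  have hpow : t ^ (α + 2) = t ^ (α + 1) * t := by
    rw [← Real.rpow_add_one ht.ne']; ring_nf
  have hs : 0 < t ^ (α + 1) := Real.rpow_pos_of_pos ht _
  rw [hpow] at h
  have hpq : p ≤ q := by
    have : 0 ≤ 2 * K * (t ^ (α + 1) * t) := by positivity
    linarith
  have h1 := timeBound_tangent hL hα hαβ hK hp hpq hq
  rw [← htdef] at h1
  have h2 : 2 * t ≤ (q - p) * (K * t ^ (α + 1))⁻¹ := by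
    rw [← div_eq_mul_inv, le_div_iff₀ (by positivity)]
    linarith
  linarith

theorem exists_timeBound_add_stepFun_le (hL : 0 < L) (hα : 0 ≤ α) (hαβ : α < β - 1)
    {ε : ℝ} (hε : 0 < ε) :
    ∃ q₀ > 0, ∀ q, 0 ≤ q → q < q₀ → timeBound L α β K q + stepFun L β q ≤ ε := by
  have hβ : 0 < β := by linarith
  have hγ : 0 < (β - α - 1) / β := div_pos (by linarith) hβ
  have hcont : ContinuousAt (fun q : ℝ => powerBound α β K q + q ^ (1 / β)) 0 := by
    unfold powerBound
    have h1 := Real.continuousAt_rpow_const 0 ((β - α - 1) / β) (Or.inr hγ.le)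
    have h2 := Real.continuousAt_rpow_const 0 (1 / β) (Or.inr (by positivity))
    exact ((continuousAt_const.mul h1).div_const _).add h2
  have hz : powerBound α β K 0 + (0 : ℝ) ^ (1 / β) = 0 := by
    rw [powerBound, Real.zero_rpow hγ.ne', Real.zero_rpow (by positivity)]; simp
  have hev : ∀ᶠ q in 𝓝 (0 : ℝ), powerBound α β K q + q ^ (1 / β) < ε :=
    hcont.eventually (gt_mem_nhds (hz.trans_lt hε))
  obtain ⟨r, hr, hball⟩ := Metric.eventually_nhds_iff.1 hev
  have hm : 0 < min 1 (1 / (2 * L)) ^ β :=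
    Real.rpow_pos_of_pos (lt_min one_pos (by positivity)) _
  refine ⟨min r (min 1 (1 / (2 * L)) ^ β), lt_min hr hm, fun q hq0 hq => ?_⟩
  have h1 := hball (y := q) (by
    rw [Real.dist_eq, sub_zero, abs_of_nonneg hq0]; exact hq.trans_le (min_le_left _ _))
  rw [timeBound_eq hL hα hαβ, min_eq_left (hq.le.trans (min_le_right _ _)), sub_self, zero_mul,
    add_zero]
  have h2 : stepFun L β q ≤ q ^ (1 / β) := (min_le_right _ _).trans (min_le_right _ _)
  linarith

end TimeBound

/-! ### The minimum time -/

section MinTime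

variable {d : ℕ} {F : P2 d → E d → Set (E d)} {φ : E d →ᵇ ℝ} {D : Set (P2 d)} {L C α β K : ℝ}

theorem mem_target_singleton {μ : P2 d} : μ ∈ target {φ} ↔ ∫ x, φ x ∂μ.meas ≤ 0 := by
  simp [target]

theorem stepTime_eq_stepFun (μ : P2 d) :
    stepTime {φ} L β μ = stepFun L β (max (∫ x, φ x ∂μ.meas) 0) := by
  rw [stepTime, sigma_singleton, stepFun]

theorem stepTime_of_mem_target (hL : 0 < L) (hβ : 0 < β) {μ : P2 d} (hμ : μ ∈ target {φ}) :
    stepTime {φ} L β μ = 0 := by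
  rw [stepTime_eq_stepFun, max_eq_right (mem_target_singleton.1 hμ), stepFun,
    Real.zero_rpow (by positivity), min_eq_right (by positivity : 0 ≤ 1 / (2 * L)),
    min_eq_right zero_le_one]

theorem minTime_le_of_isDrivenBy {c : ℝ → P2 d} {v : ℝ → E d → E d} {T : ℝ} (hT : 0 ≤ T)
    (h : IsDrivenBy F 0 T c v) (hc : c T ∈ target {φ}) :
    minTime F {φ} (c 0) ≤ ENNReal.ofReal T :=
  sInf_le ⟨T, hT, ⟨c, ⟨isAdmissible_iff.2 ⟨v, h⟩, rfl⟩, hc⟩, rfl⟩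

theorem exists_next (hL : 0 < L) (hβ : 0 < β) (hC : 0 ≤ C) (hφ : SemiconcaveWith φ C)
    (hD : ∀ μ ∈ D \ target {φ}, DescentAt F φ D L C α β K μ) (μ : D) :
    ∃ ν : D, (∃ c ∈ Adm F 0 (stepTime {φ} L β μ.1) μ.1, c (stepTime {φ} L β μ.1) = ν.1) ∧
      (μ.1 ∉ target {φ} → ∫ x, φ x ∂ν.1.meas ≤
        ∫ x, φ x ∂μ.1.meas - 2 * K * stepTime {φ} L β μ.1 ^ (α + 2)) := by
  by_cases hμ : μ.1 ∈ target {φ}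
  · refine ⟨μ, ⟨fun _ => μ.1, ⟨isAdmissible_iff.2 ⟨fun _ _ => 0, ?_⟩, rfl⟩, rfl⟩,
      fun h => absurd hμ h⟩
    rw [stepTime_of_mem_target hL hβ hμ]
    exact isDrivenBy_singleton 0 _ measurable_const
  · have hpos : 0 < stepTime {φ} L β μ.1 := by
      rw [mem_target_singleton, not_le] at hμ
      rw [stepTime_eq_stepFun]
      exact stepFun_pos hL (lt_max_of_lt_left hμ)
    obtain ⟨c, hc, hcD, hle⟩ := (hD μ.1 ⟨μ.2, hμ⟩).exists_step hC hφ hpos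
    exact ⟨⟨_, hcD⟩, ⟨c, hc, rfl⟩, fun _ => hle⟩

theorem minTime_le_timeBound (hF : StandingHyp F L) (hC : 0 ≤ C) (hα : 0 ≤ α) (hαβ : α < β - 1)
    (hK : 0 < K) (hφ : SemiconcaveWith φ C)
    (hD : ∀ μ ∈ D \ target {φ}, DescentAt F φ D L C α β K μ) {μ : P2 d} (hμ : μ ∈ D) :
    minTime F {φ} μ ≤
      ENNReal.ofReal (timeBound L α β K (max (sigma {φ} μ) 0) + stepTime {φ} L β μ) ∧
    ((∀ ν ∈ D \ target {φ}, K * stepTime {φ} L β ν ^ (α + 2) ≤ sigma {φ} ν) →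
      minTime F {φ} μ ≤ ENNReal.ofReal (timeBound L α β K (max (sigma {φ} μ) 0))) := by
  have hL := hF.pos
  have hβ : 0 < β := by linarith
  choose next hnext hdec using exists_next hL hβ hC hφ hD
  set m : ℕ → D := fun n => next^[n] ⟨μ, hμ⟩ with hm
  have hm0 : (m 0).1 = μ := rfl
  have hms : ∀ n, m (n + 1) = next (m n) := fun n => Function.iterate_succ_apply' next n _
  set s : ℕ → ℝ := fun n => ∫ x, φ x ∂(m n).1.meas with hs
  set τ : ℕ → ℝ := fun n => stepTime {φ} L β (m n).1 with hτ
  have hτs : ∀ n, τ n = stepFun L β (max (s n) 0) := fun n => stepTime_eq_stepFun _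
  have hτ0 : ∀ n, 0 ≤ τ n := fun n => by
    rw [hτs]; exact stepFun_nonneg hL (le_max_right _ _)
  have hσ : sigma {φ} μ = s 0 := sigma_singleton _ _
  have hstep0 : stepTime {φ} L β μ = τ 0 := rfl
  rw [hσ, hstep0]
  obtain ⟨c, v, hcv⟩ := exists_concatenation (F := F) (μ := fun n => (m n).1) hτ0 fun i => by
    rw [hms]; exact hnext (m i)
  have hc0 : c 0 = μ := by simpa [hm0] using (hcv 0).2
  set S : ℕ → ℝ := fun n => ∑ i ∈ Finset.range n, τ i with hS
  have hS0 : ∀ n, 0 ≤ S n := fun n => Finset.sum_nonneg fun i _ => hτ0 i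
  have hdec' : ∀ n, 0 < s n → s (n + 1) ≤ s n - 2 * K * stepFun L β (s n) ^ (α + 2) := by
    intro n hn
    have h1 := hdec (m n) (by rw [mem_target_singleton, not_le]; exact hn)
    rw [← hms] at h1
    have h2 : τ n = stepFun L β (s n) := by rw [hτs, max_eq_left hn.le]
    rw [← h2]
    exact h1
  have hdec'' : ∀ n, 0 < s n → s (n + 1) ≤ s n := fun n hn => by
    have h1 := hdec' n hn
    have h2 := Real.rpow_nonneg (stepFun_nonneg (β := β) hL hn.le) (α + 2)
    have : 0 ≤ 2 * K * stepFun L β (s n) ^ (α + 2) := by positivity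
    linarith
  -- The tangent inequality is used only between nonnegative values of the observable, so the last
  -- step before the target is left out.
  have hsum : ∀ n, (∀ i ≤ n, 0 < s i) →
      s n ≤ s 0 ∧ 2 * S n + timeBound L α β K (s n) ≤ timeBound L α β K (s 0) := by
    intro n
    induction n with
    | zero => intro _; simp [hS]
    | succ n ih =>
      intro hpos
      have hn := hpos n (Nat.le_succ n)
      obtain ⟨ih1, ih2⟩ := ih fun i hi => hpos i (hi.trans (Nat.le_succ n))
      refine ⟨(hdec'' n hn).trans ih1, ?_⟩
      have h1 := two_mul_stepFun_add_timeBound_le hL hα hαβ hK (hpos (n + 1) le_rfl).le hn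
        (hdec' n hn)
      have h2 : τ n = stepFun L β (s n) := by rw [hτs, max_eq_left hn.le]
      have h3 : S (n + 1) = S n + τ n := Finset.sum_range_succ _ _
      rw [h3, h2]
      linarith
  by_cases hfin : ∃ n, s n ≤ 0
  · classical
    have hle : minTime F {φ} μ ≤ ENNReal.ofReal (S (Nat.find hfin)) := by
      rw [← hc0]
      refine minTime_le_of_isDrivenBy (hS0 _) (hcv _).1 ?_
      rw [(hcv _).2, mem_target_singleton]
      exact Nat.find_spec hfin
    rcases Nat.eq_zero_or_eq_succ_pred (Nat.find hfin) with h0 | hN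
    · have hz : S (Nat.find hfin) = 0 := by rw [h0]; simp [hS]
      rw [hz, ENNReal.ofReal_zero] at hle
      exact ⟨hle.trans bot_le, fun _ => hle.trans bot_le⟩
    set n := (Nat.find hfin).pred
    have hpos : ∀ i ≤ n, 0 < s i := fun i hi =>
      not_le.1 (Nat.find_min hfin (by omega))
    obtain ⟨h1, h2⟩ := hsum n hpos
    have hn := hpos n le_rfl
    have h3 : S (Nat.find hfin) = S n + τ n := by rw [hN]; exact Finset.sum_range_succ _ _
    have h4 : τ n = stepFun L β (s n) := by rw [hτs, max_eq_left hn.le]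
    rw [h3] at hle
    rw [max_eq_left (hn.le.trans h1)]
    refine ⟨hle.trans (ENNReal.ofReal_le_ofReal ?_), fun hcond =>
      hle.trans (ENNReal.ofReal_le_ofReal ?_)⟩
    -- The observable decreases, so the last step is no longer than the first.
    · have h5 : τ n ≤ τ 0 := by
        rw [h4, hτs 0]
        exact stepFun_mono hβ hn.le (h1.trans (le_max_left _ _))
      have h6 := timeBound_nonneg hL hα hαβ hK hn.le
      linarith [hS0 n]
    · have hc := hcond (m n).1 ⟨(m n).2, by rw [mem_target_singleton, not_le]; exact hn⟩
      rw [sigma_singleton] at hc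
      change K * τ n ^ (α + 2) ≤ s n at hc
      have ht : 0 < τ n := by rw [h4]; exact stepFun_pos hL hn
      have hp : 0 < τ n ^ (α + 1) := Real.rpow_pos_of_pos ht _
      have h5 := mul_inv_stepFun_le_timeBound hL hα hαβ hK hn
      rw [← h4] at h5
      have hpow : τ n ^ (α + 2) = τ n ^ (α + 1) * τ n := by
        rw [← Real.rpow_add_one ht.ne']; ring_nf
      -- By the extra hypothesis the last step is at most the tangent increment from `0` to `s n`,
      -- hence at most `timeBound` at `s n`, which `hsum` has kept in reserve.
      have h6 : τ n ≤ s n * (K * τ n ^ (α + 1))⁻¹ := by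
        rw [← div_eq_mul_inv, le_div_iff₀ (by positivity)]
        rw [hpow] at hc
        linarith
      linarith [hS0 n]
  · push Not at hfin
    have hbound : ∀ n, S n ≤ timeBound L α β K (s 0) := fun n => by
      have h1 := (hsum n fun i _ => hfin i).2
      have h2 := timeBound_nonneg hL hα hαβ hK (hfin n).le
      linarith [hS0 n]
    have hτpos : ∀ n, 0 < τ n := fun n => by
      rw [hτs]; exact stepFun_pos hL (lt_max_of_lt_left (hfin n))
    have hsummable : Summable τ := summable_of_sum_range_le hτ0 hbound
    set T := ∑' n, τ n with hT
    have hTle : T ≤ timeBound L α β K (s 0) := Real.tsum_le_of_sum_range_le hτ0 hbound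
    have hSlim : Tendsto S atTop (𝓝 T) := hsummable.hasSum.tendsto_sum_nat
    have hST : ∀ n, S n < T := fun n => by
      have h1 : S (n + 1) ≤ T := hsummable.sum_le_tsum _ fun i _ => hτ0 i
      have h2 : S (n + 1) = S n + τ n := Finset.sum_range_succ _ _
      linarith [hτpos n]
    have hT0 : 0 < T := (hS0 0).trans_lt (hST 0)
    have hdriven : ∀ T' < T, IsDrivenBy F 0 T' c v := fun T' hT' => by
      obtain ⟨n, hn⟩ := (hSlim.eventually (lt_mem_nhds hT')).exists
      exact (hcv n).1.mono (Icc_subset_Icc_right hn.le)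
    obtain ⟨ν, hν, hνd⟩ := hF.exists_extension hT0 hdriven
    have hSlim' : Tendsto S atTop (𝓝[<] T) :=
      tendsto_nhdsWithin_iff.2 ⟨hSlim, Eventually.of_forall hST⟩
    have hWn : Tendsto (fun n => W2 (m n).1 ν) atTop (𝓝 0) :=
      (hν.comp hSlim').congr fun n => by rw [Function.comp_apply, (hcv n).2]
    have hsanti : Antitone s := antitone_nat_of_succ_le fun n => hdec'' n (hfin n)
    have hνt : ν ∈ target {φ} := by
      rw [mem_target_singleton]
      by_contra hcon
      rw [not_le] at hcon
      set e := ∫ x, φ x ∂ν.meas with he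
      -- If the observable stayed above `e / 2`, the steps would be bounded below and could not be
      -- summable.
      obtain ⟨n₀, hn₀⟩ : ∃ n, s n < e / 2 := by
        by_contra! hall
        have hlb : ∀ n, stepFun L β (e / 2) ≤ τ n := fun n => by
          rw [hτs]
          exact stepFun_mono hβ (by positivity) ((hall n).trans (le_max_left _ _))
        have h1 := ge_of_tendsto' hsummable.tendsto_atTop_zero hlb
        exact absurd (stepFun_pos (β := β) hL (by positivity : 0 < e / 2)) (not_lt.2 h1)
      have hΛ : 0 ≤ 2 * ‖φ‖ + C := by positivity
      -- Chosen so that `W2`-closeness `δ` changes the observable by at most `e / 4`: its value near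
      -- `ν` is then at least `3 e / 4`, against `s n < e / 2`.
      set δ := e / (4 * (2 * ‖φ‖ + C + 1)) with hδ
      have hδ0 : 0 < δ := by positivity
      obtain ⟨n, hn, hnn⟩ := ((hWn.eventually (gt_mem_nhds (ENNReal.ofReal_pos.2 hδ0))).and
        (eventually_ge_atTop n₀)).exists
      have h1 := abs_integral_sub_le_of_W2_lt hC hφ hδ0 hn
      have h2 : (2 * ‖φ‖ + C) * δ ≤ e / 4 := by
        rw [hδ, mul_div_assoc', div_le_div_iff₀ (by positivity) (by norm_num)]
        nlinarith
      have h3 := hsanti hnn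
      have h4 := (abs_le.1 h1).1
      change -((2 * ‖φ‖ + C) * δ) ≤ s n - e at h4
      linarith
    have hle : minTime F {φ} μ ≤ ENNReal.ofReal T := by
      have h0 : Function.update c T ν 0 = μ := by rw [Function.update_of_ne hT0.ne, hc0]
      rw [← h0]
      refine minTime_le_of_isDrivenBy hT0.le hνd ?_
      rwa [Function.update_self]
    rw [max_eq_left (hfin 0).le]
    refine ⟨hle.trans (ENNReal.ofReal_le_ofReal ?_), fun _ =>
      hle.trans (ENNReal.ofReal_le_ofReal hTle)⟩
    linarith [hτ0 0]

theorem stlaOn_of_descent (hF : StandingHyp F L) (hC : 0 ≤ C) (hα : 0 ≤ α) (hαβ : α < β - 1)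
    (hK : 0 < K) (hφ : SemiconcaveWith φ C)
    (hD : ∀ μ ∈ D \ target {φ}, DescentAt F φ D L C α β K μ) : STLAOn F {φ} D := by
  intro ε hε μhat hμhat
  obtain ⟨q₀, hq₀, hsmall⟩ := exists_timeBound_add_stepFun_le (K := K) hF.pos hα hαβ hε
  have hΛ : 0 ≤ 2 * ‖φ‖ + C := by positivity
  set δ := q₀ / (4 * (2 * ‖φ‖ + C + 1)) with hδ
  have hδ0 : 0 < δ := by positivity
  refine ⟨δ, hδ0, fun μ hμ hW => ?_⟩
  refine (minTime_le_timeBound hF hC hα hαβ hK hφ hD hμ).1.trans (ENNReal.ofReal_le_ofReal ?_)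
  rw [stepTime_eq_stepFun, sigma_singleton]
  refine hsmall _ (le_max_right _ _) (max_lt ?_ hq₀)
  -- The radius is doubled because the estimate needs a strict inequality; the change is still at
  -- most `q₀ / 2`.
  have h1 := abs_integral_sub_le_of_W2_lt hC hφ (δ := 2 * δ) (by positivity)
    (hW.trans_lt ((ENNReal.ofReal_lt_ofReal_iff (by positivity)).2 (by linarith)))
  have h2 : (2 * ‖φ‖ + C) * (2 * δ) ≤ q₀ / 2 := by
    rw [hδ, mul_div_assoc', mul_div_assoc', div_le_div_iff₀ (by positivity) (by norm_num)]
    nlinarith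
  have h3 := mem_target_singleton.1 hμhat
  linarith [(abs_le.1 h1).2]

end MinTime

end WassersteinTarget

theorem mainTheorem10 {d : ℕ} (F : P2 d → E d → Set (E d)) (L : ℝ) (hF : StandingHyp F L)
    (φ : E d →ᵇ ℝ) (C α β K : ℝ) (hC : 0 ≤ C) (hα : 0 ≤ α) (hαβ : α < β - 1) (hK : 0 < K)
    (hφ : SemiconcaveWith φ C) (D : Set (P2 d))
    (hD : ∀ μ ∈ D \ target {φ}, DescentAt F φ D L C α β K μ) :
    STLAOn F {φ} D ∧
    (∀ μ ∈ D, minTime F {φ} μ ≤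
      ENNReal.ofReal (timeBound L α β K (max (sigma {φ} μ) 0) + stepTime {φ} L β μ)) ∧
    ((∀ ν ∈ D \ target {φ}, K * stepTime {φ} L β ν ^ (α + 2) ≤ sigma {φ} ν) →
      ∀ μ ∈ D, minTime F {φ} μ ≤
        ENNReal.ofReal (timeBound L α β K (max (sigma {φ} μ) 0))) := by
  exact ⟨stlaOn_of_descent hF hC hα hαβ hK hφ hD,
    fun μ hμ => (minTime_le_timeBound hF hC hα hαβ hK hφ hD hμ).1,
    fun hcond μ hμ => (minTime_le_timeBound hF hC hα hαβ hK hφ hD hμ).2 hcond⟩
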